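/- Let $H$ be a real Hilbert space and let $A:D(A)\to H$ be a linear positive self-adjoint operator with compact inverse, with eigenvalues $0<\lambda_1\le\lambda_2\le\cdots$ (counted with multiplicity) and a corresponding orthonormal basis $\{e_k\}_{k=1}^\infty$ of eigenvectors of $H$. Let $\mathbb H:=H\times H$ with the norm $\|(u,v)\|_{\mathbb H}^2=\|u\|_H^2+\|v\|_H^2$, let $P_nH:=\operatorname{span}\{e_1,\dots,e_n\}$, $P_n\mathbb H:=P_nH\times P_nH$, and let $Q_n\mathbb H$ be the orthogonal complement of $P_n\mathbb H$ in $\mathbb H$. For a globally Lipschitz map $F:H\to H$ consider the system $$\partial_t\begin{pmatrix}u\\v\end{pmatrix}+\begin{pmatrix}1&1\\0&1\end{pmatrix}A\begin{pmatrix}u\\v\end{pmatrix}=\begin{pmatrix}0\\F(u)\end{pmatrix},\qquad t\ge 0,\qquad (*)$$ in $\mathbb H$. A solution of $(*)$ is a function $\xi=(u,v)\in C([0,\infty),\mathbb H)$ such that, for all $w\in D(A)$ and $t\ge0$, $\frac{d}{dt}(u(t),w)+(u(t)+v(t),Aw)=0$ and $\frac{d}{dt}(v(t),w)+(v(t),Aw)=(F(u(t)),w)$.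 An inertial manifold (IM) for $(*)$ with base $P_n\mathbb H$ and tracking exponent $\theta>0$ is a closed set $\mathbb M\subset\mathbb H$ such that (1) $\mathbb S(t)\mathbb M=\mathbb M$ for all $t\ge0$, where $\mathbb S(t)$ is the solution semigroup of $(*)$; (2) $\mathbb M=\{\xi^++M(\xi^+):\xi^+\in P_n\mathbb H\}$ for some globally Lipschitz map $M:P_n\mathbb H\to Q_n\mathbb H$; (3) there is a monotone (non-decreasing) function $Q$ such that for every solution $\xi$ of $(*)$ there is a solution $\bar\xi$ of $(*)$ with $\bar\xi(t)\in\mathbb M$ and $\|\xi(t)-\bar\xi(t)\|_{\mathbb H}\le Q(\|\xi(0)\|_{\mathbb H})e^{-\theta t}$ for all $t\ge0$. Let $n\ge1$ and $L\ge0$. In both parts below the equation $(*)$ has, for every $\xi_0\in\mathbb H$, exactly one solution on $[0,\infty)$ with $\xi(0)=\xi_0$, so that $\mathbb S(t)$ is well defined. 1. If $\sqrt{\lambda_{n+1}}-\sqrt{\lambda_n}>\sqrt L$ then, for every $F:H\to H$ that is globally Lipschitz with constant $L$, equation $(*)$ possesses an IM with the $2n$-dimensional base $P_n\mathbb H$ and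 with tracking exponent $\theta=\sqrt{\lambda_n\lambda_{n+1}}$. 2. If $\sqrt{\lambda_{n+1}}-\sqrt{\lambda_n}<\sqrt L$ then there is a bounded linear operator $F:H\to H$ with $\|F\|\le L$ such that equation $(*)$ possesses no IM with base $P_n\mathbb H$ (whatever the tracking exponent). -/

import Mathlib

open scoped NNReal RealInnerProductSpace

/-- The phase space `ℍ = H × H` with the Hilbert norm `‖(u, v)‖² = ‖u‖² + ‖v‖²`. -/
abbrev PhaseSpace (H : Type*) : Type _ := WithLp 2 (H × H)

/-- `A : D(A) → H` is a positive self-adjoint linear operator with compact inverse. -/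
structure IsPosSelfAdjointCompactInv {H : Type*} [NormedAddCommGroup H] [InnerProductSpace ℝ H]
    [CompleteSpace H] (A : H →ₗ.[ℝ] H) : Prop where
  dense_domain : Dense (A.domain : Set H)
  selfAdjoint : IsSelfAdjoint A
  pos : ∀ x : A.domain, (x : H) ≠ 0 → 0 < ⟪A x, (x : H)⟫
  compact_inverse : ∃ R : H →L[ℝ] H, IsCompactOperator R ∧
    (∀ h : H, ∃ x : A.domain, (x : H) = R h ∧ A x = h) ∧ (∀ x : A.domain, R (A x) = x)

/-- `lam 0 ≤ lam 1 ≤ …` are the eigenvalues of `A`, enumerated in non-decreasing order with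
multiplicities, and `e` is a corresponding orthonormal basis of eigenvectors of `H`.
Indices start at `0`: `lam k` is the eigenvalue `λ_{k+1}` and `e k` is the vector `e_{k+1}`. -/
structure IsEigenbasis {H : Type*} [NormedAddCommGroup H] [InnerProductSpace ℝ H]
    (A : H →ₗ.[ℝ] H) (lam : ℕ → ℝ) (e : HilbertBasis ℕ ℝ H) : Prop where
  mono : Monotone lam
  eigen : ∀ k : ℕ, ∃ x : A.domain, (x : H) = e k ∧ A x = lam k • e k

/-- `P_n H`, the span of the first `n` eigenvectors. -/
def modes {H : Type*} [NormedAddCommGroup H] [InnerProductSpace ℝ H]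
    (e : HilbertBasis ℕ ℝ H) (n : ℕ) : Submodule ℝ H :=
  Submodule.span ℝ ((fun k => e k) '' Set.Iio n)

/-- `P_n ℍ = P_n H × P_n H`, as a subspace of `ℍ`. Its orthogonal complement is `Q_n ℍ`. -/
def base {H : Type*} [NormedAddCommGroup H] [InnerProductSpace ℝ H]
    (e : HilbertBasis ℕ ℝ H) (n : ℕ) : Submodule ℝ (PhaseSpace H) :=
  ((modes e n).prod (modes e n)).comap (WithLp.linearEquiv 2 ℝ (H × H)).toLinearMap

/-- `ξ = (u, v)`, restricted to `t ≥ 0`, is a solution of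
`∂ₜu + A u + A v = 0`, `∂ₜv + A v = F(u)`:
it is continuous on `[0, ∞)` with values in `ℍ`, and the two equations hold for every `t ≥ 0`
after taking the inner product with an arbitrary `w ∈ D(A)` and moving the self-adjoint operator
`A` onto `w`. (For Lipschitz `F` these are exactly the mild solutions given by the variation of
constants formula.) -/
structure IsSolution {H : Type*} [NormedAddCommGroup H] [InnerProductSpace ℝ H]
    (A : H →ₗ.[ℝ] H) (F : H → H) (ξ : ℝ → PhaseSpace H) : Prop where
  continuousOn : ContinuousOn ξ (Set.Ici 0)
  eq_fst : ∀ w : A.domain, ∀ t : ℝ, 0 ≤ t →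
    HasDerivWithinAt (fun s => ⟪(ξ s).fst, (w : H)⟫)
      (-⟪(ξ t).fst, A w⟫ - ⟪(ξ t).snd, A w⟫) (Set.Ici 0) t
  eq_snd : ∀ w : A.domain, ∀ t : ℝ, 0 ≤ t →
    HasDerivWithinAt (fun s => ⟪(ξ s).snd, (w : H)⟫)
      (-⟪(ξ t).snd, A w⟫ + ⟪F (ξ t).fst, (w : H)⟫) (Set.Ici 0) t

/-- `S(t) : ℍ → ℍ`, `t ≥ 0`, is the solution semigroup of the system: for every `ξ₀ ∈ ℍ` the
function `t ↦ S(t) ξ₀` is the unique solution starting from `ξ₀`. The values of `S` at negative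
times carry no information. -/
structure IsSolutionSemigroup {H : Type*} [NormedAddCommGroup H] [InnerProductSpace ℝ H]
    (A : H →ₗ.[ℝ] H) (F : H → H) (S : ℝ → PhaseSpace H → PhaseSpace H) : Prop where
  zero : ∀ ξ₀ : PhaseSpace H, S 0 ξ₀ = ξ₀
  isSolution : ∀ ξ₀ : PhaseSpace H, IsSolution A F (fun t => S t ξ₀)
  unique : ∀ ξ : ℝ → PhaseSpace H, IsSolution A F ξ → ∀ t : ℝ, 0 ≤ t → ξ t = S t (ξ 0)

/-- `N ⊆ ℍ` is an inertial manifold over the base `P_n ℍ`, with tracking exponent `θ`, for the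
solution semigroup `S`. -/
structure IsInertialManifold {H : Type*} [NormedAddCommGroup H] [InnerProductSpace ℝ H]
    (S : ℝ → PhaseSpace H → PhaseSpace H) (e : HilbertBasis ℕ ℝ H) (n : ℕ) (θ : ℝ)
    (N : Set (PhaseSpace H)) : Prop where
  isClosed : IsClosed N
  /-- strict invariance -/
  invariant : ∀ t : ℝ, 0 ≤ t → S t '' N = N
  /-- `N` is the graph of a globally Lipschitz function `P_n ℍ → Q_n ℍ` -/
  graph : ∃ (M : base e n → (base e n)ᗮ) (K : ℝ≥0), LipschitzWith K M ∧
    N = Set.range fun p : base e n => (p : PhaseSpace H) + (M p : PhaseSpace H)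
  exponent_pos : 0 < θ
  /-- exponential tracking; the trace solution stays in `N` by invariance -/
  tracking : ∃ Q : ℝ → ℝ, Monotone Q ∧ ∀ ξ₀ : PhaseSpace H, ∃ η₀ ∈ N, ∀ t : ℝ, 0 ≤ t →
    ‖S t ξ₀ - S t η₀‖ ≤ Q ‖ξ₀‖ * Real.exp (-θ * t)

/-! Write α = √λ_n, β = √λ_{n+1}, g = β - α and θ = αβ. In the eigenbasis the system splits into
planar Jordan blocks with rates λ_k, coupled only through F, and everything is compared with the
decay rate θ.

Existence. The diagonal form `coneForm` is negative on P_nℍ and positive on its complement. Its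
weights are chosen so that e^{2θt}V of a difference of two trajectories decreases, with a strict
gain ε∫e^{2θr}‖·‖². In one mode this is `modal_inequality`, which leaves room for a force of size
κ‖u‖ exactly when κ < g². Summed over the modes it gives `IsModalSolution.cone_estimate`, and L < g²
makes it applicable to F.

The rest of the existence part is geometry of a `ConeSystem`. The images of the base B under S t
remain graphs over B with chords in the cone V ≤ 0. They converge as t → ∞: two trajectories that
end in the same fibre of the projection had V at least of order e^{2θ(t-r)} times the final squared
distance at every earlier time r, whereas the `growth` bound allows the weighted integral only
O(e^{2θt}); hence the final distance is O(t^{-1/2}). The limit graph is the manifold. To track ξ₀,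
choose on the manifold trajectories that share the fibre of S j ξ₀ at time j; V of the difference is
nonnegative up to time j, so the gain term bounds the difference by a multiple of e^{-θt}, and a
subsequence converges as j → ∞.

Obstruction. A force -g² on the last base mode and on the first mode outside the base changes their
decay rates to α² ± αg and β² ± βg. One rate of each pair equals αβ. The remaining strength c = L -
g² > 0 couples the two resonant directions into a Jordan block. A base point of size e^{θT} that
reaches unit size at time T then needs an outer component of order Te^{θT}, and no Lipschitz graph
provides it (`not_exists_invariant_graph`). Only invariance and the Lipschitz graph property are
contradicted, so the tracking exponent is irrelevant. -/

/-! ### Abstract strong cone condition and graph transform. -/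

/-- A semigroup `S` on a Hilbert space whose trajectories satisfy the strong cone condition with
respect to a quadratic form `V` that is negative on the finite dimensional space `B` and positive on
its orthogonal complement. -/
structure ConeSystem {X : Type*} [NormedAddCommGroup X] [InnerProductSpace ℝ X]
    (B : Submodule ℝ X) [FiniteDimensional ℝ B] (S : ℝ → X → X) (V : X → ℝ)
    (θ Λ ε a b c C D : ℝ) : Prop where
  theta_pos : 0 < θ
  eps_pos : 0 < ε
  a_pos : 0 < a
  b_pos : 0 < b
  lambda_nonneg : 0 ≤ Λ
  c_nonneg : 0 ≤ c
  C_nonneg : 0 ≤ C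
  D_nonneg : 0 ≤ D
  V_lower : ∀ x, a * ‖x - B.starProjection x‖ ^ 2 - b * ‖B.starProjection x‖ ^ 2 ≤ V x
  V_upper : ∀ x, V x ≤ b * ‖x - B.starProjection x‖ ^ 2 - a * ‖B.starProjection x‖ ^ 2
  -- `V` is not assumed to be quadratic; this is all that the tracking argument needs of its polar
  -- form.
  V_sub : ∀ x y, V (x - y) ≤ V y + c * ‖x‖ * (‖x‖ + 2 * ‖y‖)
  V_cont : Continuous V
  zero : ∀ x, S 0 x = x
  add : ∀ s t x, 0 ≤ s → 0 ≤ t → S (s + t) x = S s (S t x)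
  cont : ∀ x, ContinuousOn (fun t => S t x) (Set.Ici 0)
  lip : ∀ t x y, 0 ≤ t → ‖S t x - S t y‖ ≤ Real.exp (Λ * t) * ‖x - y‖
  cone : ∀ t x y, 0 ≤ t → Real.exp (2 * θ * t) * V (S t x - S t y) +
    ε * ∫ r in (0 : ℝ)..t, Real.exp (2 * θ * r) * ‖S r x - S r y‖ ^ 2 ≤ V (x - y)
  -- The analogue of `cone` for a single trajectory. As `0` need not be stationary, it costs an
  -- inhomogeneous term.
  growth : ∀ t x, 0 ≤ t → Real.exp (2 * θ * t) * V (S t x) +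
    ε * ∫ r in (0 : ℝ)..t, Real.exp (2 * θ * r) * ‖S r x‖ ^ 2 ≤ V x + C * Real.exp (2 * θ * t)
  near : ∀ t x y, 0 ≤ t → t ≤ 1 →
    ‖B.starProjection (S t x - S t y) - B.starProjection (x - y)‖ ≤ D * t * ‖x - y‖

/-- A set that meets every fibre of the projection onto `B` and whose chords lie in the cone
`V ≤ 0`. -/
structure IsConeGraph {X : Type*} [NormedAddCommGroup X] [InnerProductSpace ℝ X]
    (B : Submodule ℝ X) [FiniteDimensional ℝ B] (V : X → ℝ) (G : Set X) : Prop where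
  exists_over : ∀ p ∈ B, ∃ x ∈ G, B.starProjection x = p
  chord : ∀ x ∈ G, ∀ y ∈ G, V (x - y) ≤ 0

namespace ConeSystem

open Filter Topology

variable {X : Type*} [NormedAddCommGroup X] [InnerProductSpace ℝ X]
  {B : Submodule ℝ X} [FiniteDimensional ℝ B] {S : ℝ → X → X} {V : X → ℝ}
  {θ Λ ε a b c C D : ℝ}

theorem starProjection_of_mem {p : X} (hp : p ∈ B) : B.starProjection p = p :=
  Submodule.starProjection_eq_self_iff.2 hp

theorem intervalIntegrable_sub (h : ConeSystem B S V θ Λ ε a b c C D) (x y : X) {s t : ℝ}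
    (hs : 0 ≤ s) (ht : 0 ≤ t) :
    IntervalIntegrable (fun r => Real.exp (2 * θ * r) * ‖S r x - S r y‖ ^ 2)
      MeasureTheory.volume s t := by
  apply ContinuousOn.intervalIntegrable
  have hsub : Set.uIcc s t ⊆ Set.Ici 0 := fun r hr => (le_inf hs ht).trans hr.1
  have h1 := (h.cont x).mono hsub
  have h2 := (h.cont y).mono hsub
  fun_prop

theorem intervalIntegrable (h : ConeSystem B S V θ Λ ε a b c C D) (x : X) {s t : ℝ}
    (hs : 0 ≤ s) (ht : 0 ≤ t) :
    IntervalIntegrable (fun r => Real.exp (2 * θ * r) * ‖S r x‖ ^ 2)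
      MeasureTheory.volume s t := by
  apply ContinuousOn.intervalIntegrable
  have hsub : Set.uIcc s t ⊆ Set.Ici 0 := fun r hr => (le_inf hs ht).trans hr.1
  have h1 := (h.cont x).mono hsub
  fun_prop

theorem continuous (h : ConeSystem B S V θ Λ ε a b c C D) {t : ℝ} (ht : 0 ≤ t) :
    Continuous (S t) := by
  refine (LipschitzWith.of_dist_le_mul (K := ⟨Real.exp (Λ * t), (Real.exp_pos _).le⟩)
    fun x y => ?_).continuous
  rw [dist_eq_norm, dist_eq_norm]
  exact h.lip t x y ht

theorem cone_decay (h : ConeSystem B S V θ Λ ε a b c C D) {t : ℝ} (ht : 0 ≤ t) (x y : X) :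
    Real.exp (2 * θ * t) * V (S t x - S t y) ≤ V (x - y) := by
  have h1 := h.cone t x y ht
  have h2 : 0 ≤ ∫ r in (0 : ℝ)..t, Real.exp (2 * θ * r) * ‖S r x - S r y‖ ^ 2 :=
    intervalIntegral.integral_nonneg ht fun r _ => by positivity
  have := mul_nonneg h.eps_pos.le h2
  linarith

/-- A single trajectory may leave the cone `V ≤ 0`, but only up to the level `C`, uniformly in time.
This makes the estimates on the images of the base independent of their age. -/
theorem growth_le (h : ConeSystem B S V θ Λ ε a b c C D) {t : ℝ} (ht : 0 ≤ t) {x : X}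
    (hx : V x ≤ 0) : V (S t x) ≤ C := by
  have h1 := h.growth t x ht
  have h2 : 0 ≤ ∫ r in (0 : ℝ)..t, Real.exp (2 * θ * r) * ‖S r x‖ ^ 2 :=
    intervalIntegral.integral_nonneg ht fun r _ => by positivity
  have h3 := mul_nonneg h.eps_pos.le h2
  have h4 : Real.exp (2 * θ * t) * V (S t x) ≤ Real.exp (2 * θ * t) * C := by linarith
  exact le_of_mul_le_mul_left h4 (Real.exp_pos _)

theorem chord_image (h : ConeSystem B S V θ Λ ε a b c C D) {t : ℝ} (ht : 0 ≤ t) {x y : X}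
    (hxy : V (x - y) ≤ 0) : V (S t x - S t y) ≤ 0 := by
  have := (h.cone_decay ht x y).trans hxy
  by_contra! hpos
  have := mul_pos (Real.exp_pos (2 * θ * t)) hpos
  linarith

/-- The norm of a difference of trajectories is controlled by its integral over a unit of time. -/
theorem sq_norm_le_integral (h : ConeSystem B S V θ Λ ε a b c C D) {t : ℝ} (ht : 1 ≤ t) (x y : X) :
    Real.exp (2 * θ * (t - 1)) * (Real.exp (-(2 * Λ)) * ‖S t x - S t y‖ ^ 2) ≤
      ∫ r in (0 : ℝ)..t, Real.exp (2 * θ * r) * ‖S r x - S r y‖ ^ 2 := by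
  have hsplit := intervalIntegral.integral_add_adjacent_intervals
    (h.intervalIntegrable_sub x y le_rfl (by linarith : (0 : ℝ) ≤ t - 1))
    (h.intervalIntegrable_sub x y (by linarith : (0 : ℝ) ≤ t - 1) (by linarith : (0 : ℝ) ≤ t))
  have h0 : 0 ≤ ∫ r in (0 : ℝ)..(t - 1), Real.exp (2 * θ * r) * ‖S r x - S r y‖ ^ 2 :=
    intervalIntegral.integral_nonneg (by linarith) fun r _ => by positivity
  have h1 : (∫ r in (t - 1)..t,
      Real.exp (2 * θ * (t - 1)) * (Real.exp (-(2 * Λ)) * ‖S t x - S t y‖ ^ 2)) ≤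
      ∫ r in (t - 1)..t, Real.exp (2 * θ * r) * ‖S r x - S r y‖ ^ 2 := by
    refine intervalIntegral.integral_mono_on (by linarith) (by simp)
      (h.intervalIntegrable_sub x y (by linarith) (by linarith)) fun r hr => ?_
    have hr0 : 0 ≤ r := by linarith [hr.1]
    have hθ := h.theta_pos
    have e1 : Real.exp (2 * θ * (t - 1)) ≤ Real.exp (2 * θ * r) := by
      gcongr; exact hr.1
    have e2 : ‖S t x - S t y‖ ≤ Real.exp Λ * ‖S r x - S r y‖ := by
      have e3 := h.lip (t - r) (S r x) (S r y) (by linarith [hr.2])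
      rw [← h.add _ _ _ (by linarith [hr.2]) hr0, ← h.add _ _ _ (by linarith [hr.2]) hr0,
        sub_add_cancel] at e3
      refine e3.trans ?_
      gcongr
      nlinarith [h.lambda_nonneg, hr.1]
    have e4 : Real.exp (-(2 * Λ)) * ‖S t x - S t y‖ ^ 2 ≤ ‖S r x - S r y‖ ^ 2 := by
      calc Real.exp (-(2 * Λ)) * ‖S t x - S t y‖ ^ 2
          ≤ Real.exp (-(2 * Λ)) * (Real.exp Λ * ‖S r x - S r y‖) ^ 2 := by gcongr
        _ = (Real.exp (-(2 * Λ)) * Real.exp Λ ^ 2) * ‖S r x - S r y‖ ^ 2 := by ring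
        _ = ‖S r x - S r y‖ ^ 2 := by
            rw [← Real.exp_nat_mul, ← Real.exp_add]; simp
    gcongr
  rw [intervalIntegral.integral_const] at h1
  simp only [sub_sub_cancel, smul_eq_mul, one_mul] at h1
  linarith

/-- After a unit of time, chords in the cone lie in a strictly smaller cone. -/
theorem strict_cone (h : ConeSystem B S V θ Λ ε a b c C D) {t : ℝ} (ht : 1 ≤ t) {x y : X}
    (hxy : V (x - y) ≤ 0) :
    V (S t x - S t y) ≤
      -(ε * Real.exp (-(2 * θ)) * Real.exp (-(2 * Λ))) * ‖S t x - S t y‖ ^ 2 := by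
  have h1 := h.cone t x y (by linarith)
  have h2 := mul_le_mul_of_nonneg_left (h.sq_norm_le_integral ht x y) h.eps_pos.le
  have h3 : Real.exp (2 * θ * (t - 1)) = Real.exp (2 * θ * t) * Real.exp (-(2 * θ)) := by
    rw [← Real.exp_add]; ring_nf
  rw [h3] at h2
  refine le_of_mul_le_mul_left ?_ (Real.exp_pos (2 * θ * t))
  linarith

/-- The aperture of the cone `V ≤ 0`. -/
theorem norm_sub_proj_le (h : ConeSystem B S V θ Λ ε a b c C D) {x : X} (hx : V x ≤ 0) :
    ‖x - B.starProjection x‖ ≤ √(b / a) * ‖B.starProjection x‖ := by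
  have h1 := h.V_lower x
  have ha := h.a_pos
  have hb := h.b_pos
  refine le_of_sq_le_sq ?_ (by positivity)
  rw [mul_pow, Real.sq_sqrt (by positivity), div_mul_eq_mul_div, le_div_iff₀ ha]
  linarith

theorem norm_le_of_cone (h : ConeSystem B S V θ Λ ε a b c C D) {x : X} (hx : V x ≤ 0) :
    ‖x‖ ≤ (1 + √(b / a)) * ‖B.starProjection x‖ := by
  have h1 := h.norm_sub_proj_le hx
  have h2 := norm_add_le (x - B.starProjection x) (B.starProjection x)
  rw [sub_add_cancel] at h2
  linarith

theorem V_base_le (h : ConeSystem B S V θ Λ ε a b c C D) {x : X} (hx : x ∈ B) : V x ≤ 0 := by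
  have h1 := h.V_upper x
  rw [starProjection_of_mem hx] at h1
  have := h.a_pos
  simp only [sub_self, norm_zero] at h1
  nlinarith [sq_nonneg ‖x‖]

theorem isConeGraph_base (h : ConeSystem B S V θ Λ ε a b c C D) :
    IsConeGraph B V (B : Set X) where
  exists_over p hp := ⟨p, hp, starProjection_of_mem hp⟩
  chord _ hx _ hy := h.V_base_le (B.sub_mem hx hy)

/-- Over a short time the base dynamics on a cone graph is a small perturbation of the identity. -/
theorem isConeGraph_image_short (h : ConeSystem B S V θ Λ ε a b c C D) {G : Set X}
    (hG : IsConeGraph B V G) {t : ℝ} (ht : 0 ≤ t) (ht1 : t ≤ 1)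
    (hsmall : D * t * (1 + √(b / a)) ≤ 1 / 2) : IsConeGraph B V (S t '' G) where
  exists_over p hp := by
    choose g hgG hgP using fun q : B => hG.exists_over q q.2
    -- A fixed point of `Ψ` is a `q` for which `S t (g q)` projects to `p`. By `near`, the
    -- projection of `S t (g q)` differs from `q` by a map with small Lipschitz constant, so `Ψ`
    -- contracts.
    let Ψ : B → B := fun q => q - B.orthogonalProjectionOnto (S t (g q)) + ⟨p, hp⟩
    have hΨ : ContractingWith (1 / 2 : ℝ≥0) Ψ := by
      refine ⟨by rw [← NNReal.coe_lt_coe]; norm_num, LipschitzWith.of_dist_le_mul fun q r => ?_⟩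
      have h1 := h.near t (g q) (g r) ht ht1
      have h2 := h.norm_le_of_cone (hG.chord _ (hgG q) _ (hgG r))
      rw [map_sub, hgP, hgP] at h2
      rw [map_sub _ (g q), hgP, hgP] at h1
      rw [dist_eq_norm, dist_eq_norm]
      change ‖((Ψ q - Ψ r : B) : X)‖ ≤ _ * ‖(q : X) - r‖
      have h3 : ((Ψ q - Ψ r : B) : X) =
          -(B.starProjection (S t (g q) - S t (g r)) - ((q : X) - r)) := by
        simp only [Ψ, Submodule.coe_sub, Submodule.coe_add, map_sub,
          Submodule.starProjection_apply]
        abel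
      rw [h3, norm_neg]
      refine h1.trans ?_
      have hD := h.D_nonneg
      calc D * t * ‖g q - g r‖ ≤ D * t * ((1 + √(b / a)) * ‖(q : X) - r‖) := by gcongr
        _ = D * t * (1 + √(b / a)) * ‖(q : X) - r‖ := by ring
        _ ≤ 1 / 2 * ‖(q : X) - r‖ := by gcongr
        _ = _ := by simp
    have hfix := hΨ.fixedPoint_isFixedPt
    set q := ContractingWith.fixedPoint Ψ hΨ
    refine ⟨S t (g q), ⟨g q, hgG q, rfl⟩, ?_⟩
    have h4 : q - B.orthogonalProjectionOnto (S t (g q)) + ⟨p, hp⟩ = q := hfix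
    have h5 : B.orthogonalProjectionOnto (S t (g q)) = ⟨p, hp⟩ := by
      rw [sub_add_eq_add_sub, sub_eq_iff_eq_add] at h4
      exact (add_left_cancel h4).symm
    rw [Submodule.starProjection_apply, h5]
  chord := by
    rintro _ ⟨x, hx, rfl⟩ _ ⟨y, hy, rfl⟩
    exact h.chord_image ht (hG.chord x hx y hy)

/-- The admissible short time depends on `D`, `a`, `b` only and not on the graph, so `[0, t]` can be
cut into `j` equal steps and the short-time result iterated. -/
theorem isConeGraph_image (h : ConeSystem B S V θ Λ ε a b c C D) {G : Set X}
    (hG : IsConeGraph B V G) {t : ℝ} (ht : 0 ≤ t) : IsConeGraph B V (S t '' G) := by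
  have hD := h.D_nonneg
  obtain ⟨j, hj⟩ := exists_nat_gt (t + D * t * (1 + √(b / a)) * 2)
  have hpos : 0 ≤ D * t * (1 + √(b / a)) * 2 := by positivity
  have hj0 : (0 : ℝ) < j := by linarith
  have hs : 0 ≤ t / j := by positivity
  have hs1 : t / j ≤ 1 := by rw [div_le_one hj0]; linarith
  have hs2 : D * (t / j) * (1 + √(b / a)) ≤ 1 / 2 := by
    rw [mul_div_assoc', div_mul_eq_mul_div, div_le_iff₀ hj0]; linarith
  have key : ∀ i : ℕ, IsConeGraph B V (S (i * (t / j)) '' G) := by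
    intro i
    induction i with
    | zero =>
      have : S ((0 : ℕ) * (t / j)) = id := by ext x; simp [h.zero]
      rw [this, Set.image_id]; exact hG
    | succ i ih =>
      have h1 := h.isConeGraph_image_short ih hs hs1 hs2
      rw [Set.image_image] at h1
      have h2 : S ((i + 1 : ℕ) * (t / j)) = fun x => S (t / j) (S (i * (t / j)) x) := by
        ext x
        rw [← h.add _ _ _ hs (by positivity)]
        congr 1
        push_cast
        ring
      rwa [h2]
  have := key j
  rwa [mul_div_cancel₀ _ hj0.ne'] at this

/-- Bound of the weighted `L²` norm of a trajectory in terms of the projection of its endpoint. -/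
theorem integral_le (h : ConeSystem B S V θ Λ ε a b c C D) {t : ℝ} (ht : 0 ≤ t) {y : X}
    (hy : V y ≤ C) :
    ε * ∫ r in (0 : ℝ)..t, Real.exp (2 * θ * r) * ‖S r y‖ ^ 2 ≤
      Real.exp (2 * θ * t) * (2 * C + b * ‖B.starProjection (S t y)‖ ^ 2) := by
  have h1 := h.growth t y ht
  have h2 := h.V_lower (S t y)
  have ha := h.a_pos
  have h3 : -(b * ‖B.starProjection (S t y)‖ ^ 2) ≤ V (S t y) := by
    nlinarith [sq_nonneg ‖S t y - B.starProjection (S t y)‖]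
  have h4 := mul_le_mul_of_nonneg_left h3 (Real.exp_pos (2 * θ * t)).le
  have h5 : C ≤ C * Real.exp (2 * θ * t) :=
    le_mul_of_one_le_right h.C_nonneg (Real.one_le_exp (by have := h.theta_pos; positivity))
  linarith

/-- Two trajectories which are bounded in the weighted `L²` norm and have the same projection at the
end are close to each other at the end. -/
theorem close_of_proj_eq (h : ConeSystem B S V θ Λ ε a b c C D) {t : ℝ} (ht : 0 ≤ t) {x y : X}
    (hx : V x ≤ C) (hy : V y ≤ C)
    (hP : B.starProjection (S t x) = B.starProjection (S t y)) :
    t * ‖S t x - S t y‖ ^ 2 ≤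
      4 * b * (2 * C + b * ‖B.starProjection (S t x)‖ ^ 2) / (ε * a) := by
  have ha := h.a_pos
  have hb := h.b_pos
  have hε := h.eps_pos
  have h1 := h.integral_le ht hx
  have h2 := h.integral_le ht hy
  rw [← hP] at h2
  set R := 2 * C + b * ‖B.starProjection (S t x)‖ ^ 2
  have hlow : a * ‖S t x - S t y‖ ^ 2 ≤ V (S t x - S t y) := by
    have := h.V_lower (S t x - S t y)
    rw [map_sub, hP, sub_self] at this
    simpa using this
  -- The cone inequality from time `r` to time `t` bounds the final difference by `V` at time `r`.
  -- The left integrand does not depend on `r`, which produces the factor `t`; the right side is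
  -- `O(e^{2θt})` by `integral_le`.
  have h3 : (∫ r in (0 : ℝ)..t, Real.exp (2 * θ * t) * (a * ‖S t x - S t y‖ ^ 2)) ≤
      ∫ r in (0 : ℝ)..t, (2 * b) * (Real.exp (2 * θ * r) * ‖S r x‖ ^ 2 +
        Real.exp (2 * θ * r) * ‖S r y‖ ^ 2) := by
    refine intervalIntegral.integral_mono_on ht (by simp)
      (((h.intervalIntegrable x le_rfl ht).add
        (h.intervalIntegrable y le_rfl ht)).const_mul _) fun r hr => ?_
    have e1 := h.cone_decay (sub_nonneg.2 hr.2) (S r x) (S r y)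
    rw [← h.add _ _ _ (sub_nonneg.2 hr.2) hr.1, ← h.add _ _ _ (sub_nonneg.2 hr.2) hr.1,
      sub_add_cancel] at e1
    have e2 : V (S r x - S r y) ≤ 2 * b * (‖S r x‖ ^ 2 + ‖S r y‖ ^ 2) := by
      have f1 := h.V_upper (S r x - S r y)
      have f2 : ‖(S r x - S r y) - B.starProjection (S r x - S r y)‖ ≤ ‖S r x - S r y‖ := by
        rw [← Submodule.starProjection_orthogonal_val]
        exact Submodule.norm_starProjection_apply_le _ _
      have f3 := norm_sub_le (S r x) (S r y)
      have f4 : ‖(S r x - S r y) - B.starProjection (S r x - S r y)‖ ^ 2 ≤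
          2 * (‖S r x‖ ^ 2 + ‖S r y‖ ^ 2) := by
        have := pow_le_pow_left₀ (norm_nonneg _) (f2.trans f3) 2
        nlinarith [sq_nonneg (‖S r x‖ - ‖S r y‖)]
      nlinarith [sq_nonneg ‖B.starProjection (S r x - S r y)‖, mul_le_mul_of_nonneg_left f4 hb.le]
    have e3 : Real.exp (2 * θ * t) = Real.exp (2 * θ * r) * Real.exp (2 * θ * (t - r)) := by
      rw [← Real.exp_add]; ring_nf
    calc Real.exp (2 * θ * t) * (a * ‖S t x - S t y‖ ^ 2)
        ≤ Real.exp (2 * θ * t) * V (S t x - S t y) := by gcongr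
      _ = Real.exp (2 * θ * r) * (Real.exp (2 * θ * (t - r)) * V (S t x - S t y)) := by
          rw [e3]; ring
      _ ≤ Real.exp (2 * θ * r) * (2 * b * (‖S r x‖ ^ 2 + ‖S r y‖ ^ 2)) := by
          exact mul_le_mul_of_nonneg_left (e1.trans e2) (Real.exp_pos _).le
      _ = _ := by ring
  rw [intervalIntegral.integral_const, intervalIntegral.integral_const_mul,
    intervalIntegral.integral_add (h.intervalIntegrable x le_rfl ht)
      (h.intervalIntegrable y le_rfl ht)] at h3
  simp only [sub_zero, smul_eq_mul] at h3
  rw [le_div_iff₀ (by positivity)]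
  refine le_of_mul_le_mul_left ?_ (Real.exp_pos (2 * θ * t))
  have h4 := mul_le_mul_of_nonneg_left h3 hε.le
  have h5 := mul_le_mul_of_nonneg_left (add_le_add h1 h2) (by positivity : 0 ≤ 2 * b)
  linarith

end ConeSystem

/-! ### The limit graph, its invariance and asymptotic phase. -/

namespace ConeSystem

open Filter Topology

variable {X : Type*} [NormedAddCommGroup X] [InnerProductSpace ℝ X]
  {B : Submodule ℝ X} [FiniteDimensional ℝ B] {S : ℝ → X → X} {V : X → ℝ}
  {θ Λ ε a b c C D : ℝ}

/-- The images of the base at two times are close to each other over a common point. -/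
theorem close_of_images (h : ConeSystem B S V θ Λ ε a b c C D) {s t : ℝ} (hs : 0 ≤ s)
    (hst : s ≤ t) {x y : X} (hx : x ∈ S s '' B) (hy : y ∈ S t '' B)
    (hP : B.starProjection x = B.starProjection y) :
    s * ‖x - y‖ ^ 2 ≤ 4 * b * (2 * C + b * ‖B.starProjection x‖ ^ 2) / (ε * a) := by
  obtain ⟨x, hxB, rfl⟩ := hx
  obtain ⟨y, hyB, rfl⟩ := hy
  -- The later image is restarted at a point that need no longer lie in `B`; `growth_le` still gives
  -- `V ≤ C` there, which is why `close_of_proj_eq` asks for no more.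
  have e : S t y = S s (S (t - s) y) := by
    rw [← h.add _ _ _ hs (sub_nonneg.2 hst), add_sub_cancel]
  rw [e] at hP ⊢
  exact h.close_of_proj_eq hs ((h.V_base_le hxB).trans h.C_nonneg)
    (h.growth_le (sub_nonneg.2 hst) (h.V_base_le hyB)) hP

variable [CompleteSpace X]

/-- The images `S t '' B` of the base converge to a graph as `t → ∞`. -/
theorem exists_limit_graph (h : ConeSystem B S V θ Λ ε a b c C D) :
    ∃ m : B → X, (∀ p, B.starProjection (m p) = p) ∧
      (∀ t : ℝ, 0 ≤ t → ∀ x ∈ S t '' B, ∀ p : B, B.starProjection x = p →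
        t * ‖x - m p‖ ^ 2 ≤ 4 * b * (2 * C + b * ‖p‖ ^ 2) / (ε * a)) ∧
      ∀ p q, V (m p - m q) ≤
        -(ε * Real.exp (-(2 * θ)) * Real.exp (-(2 * Λ))) * ‖m p - m q‖ ^ 2 := by
  have hG : ∀ j : ℕ, IsConeGraph B V (S j '' B) := fun j =>
    h.isConeGraph_image h.isConeGraph_base (Nat.cast_nonneg j)
  choose g hgG hgP using fun (j : ℕ) (p : B) => (hG j).exists_over p p.2
  have hC := h.C_nonneg
  have ha := h.a_pos
  have hb := h.b_pos
  have hε := h.eps_pos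
  have hcauchy : ∀ p, CauchySeq fun j => g j p := by
    intro p
    set R := 4 * b * (2 * C + b * ‖p‖ ^ 2) / (ε * a)
    have hR : 0 ≤ R := by positivity
    have key : ∀ i j : ℕ, i ≤ j → (i : ℝ) * ‖g i p - g j p‖ ^ 2 ≤ R := by
      intro i j hij
      have := h.close_of_images (Nat.cast_nonneg i) (Nat.cast_le.2 hij) (hgG i p) (hgG j p)
        (by rw [hgP, hgP])
      rwa [hgP] at this
    rw [Metric.cauchySeq_iff']
    intro δ hδ
    obtain ⟨i, hi⟩ := exists_nat_gt (R / δ ^ 2)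
    refine ⟨i, fun j hj => ?_⟩
    rw [dist_comm, dist_eq_norm]
    have h1 := key i j hj
    rw [div_lt_iff₀ (by positivity)] at hi
    have hi0 : (0 : ℝ) ≤ i := Nat.cast_nonneg i
    by_contra! hge
    have : δ ^ 2 ≤ ‖g i p - g j p‖ ^ 2 := pow_le_pow_left₀ hδ.le hge 2
    nlinarith
  choose m hm using fun p => cauchySeq_tendsto_of_complete (hcauchy p)
  have hmP : ∀ p, B.starProjection (m p) = p := fun p =>
    tendsto_nhds_unique ((B.starProjection.continuous.tendsto _).comp (hm p))
      (by simp [Function.comp_def, hgP])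
  refine ⟨m, hmP, ?_, ?_⟩
  · intro t ht x hx p hxp
    refine le_of_tendsto (((tendsto_const_nhds.sub (hm p)).norm.pow 2).const_mul t) ?_
    obtain ⟨k, hk⟩ := exists_nat_ge t
    filter_upwards [eventually_ge_atTop k] with j hj
    have := h.close_of_images ht (hk.trans (Nat.cast_le.2 hj)) hx (hgG j p) (by rw [hxp, hgP])
    rwa [hxp] at this
  · intro p q
    have h1 := (hm p).sub (hm q)
    refine le_of_tendsto_of_tendsto ((h.V_cont.tendsto _).comp h1)
      ((h1.norm.pow 2).const_mul _) ?_
    filter_upwards [eventually_ge_atTop 1] with j hj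
    obtain ⟨x, hx, hx'⟩ := hgG j p
    obtain ⟨y, hy, hy'⟩ := hgG j q
    have := h.strict_cone (Nat.one_le_cast.2 hj) (h.isConeGraph_base.chord x hx y hy)
    rwa [hx', hy'] at this

/-- A cone system possesses an invariant Lipschitz graph over `B` which attracts all trajectories
with asymptotic phase. -/
theorem exists_inertialManifold (h : ConeSystem B S V θ Λ ε a b c C D) :
    ∃ N : Set X, IsClosed N ∧ (∀ t : ℝ, 0 ≤ t → S t '' N = N) ∧
      (∃ (M : B → Bᗮ) (K : ℝ≥0), LipschitzWith K M ∧
        N = Set.range fun p : B => (p : X) + (M p : X)) ∧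
      ∃ Q : ℝ → ℝ, Monotone Q ∧ ∀ ξ₀ : X, ∃ η₀ ∈ N, ∀ t : ℝ, 0 ≤ t →
        ‖S t ξ₀ - S t η₀‖ ≤ Q ‖ξ₀‖ * Real.exp (-θ * t) := by
  obtain ⟨m, hmP, hmclose, hmstrict⟩ := h.exists_limit_graph
  have hC := h.C_nonneg
  have ha := h.a_pos
  have hb := h.b_pos
  have hc := h.c_nonneg
  have hε := h.eps_pos
  have hθ := h.theta_pos
  have hΛ := h.lambda_nonneg
  set δ := ε * Real.exp (-(2 * θ)) * Real.exp (-(2 * Λ)) with hδdef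
  have hδ : 0 < δ := by positivity
  have hmchord : ∀ p q, V (m p - m q) ≤ 0 := fun p q =>
    (hmstrict p q).trans (by nlinarith [sq_nonneg ‖m p - m q‖])
  have hmlip : ∀ p q : B, ‖m p - m q‖ ≤ (1 + √(b / a)) * ‖p - q‖ := by
    intro p q
    have := h.norm_le_of_cone (hmchord p q)
    rwa [map_sub, hmP, hmP] at this
  have hmcont : Continuous m := (LipschitzWith.of_dist_le_mul
    (K := ⟨1 + √(b / a), by positivity⟩) fun p q => by
      rw [dist_eq_norm, dist_eq_norm]; exact hmlip p q).continuous
  set P : X → B := fun x => B.orthogonalProjectionOnto x with hPdef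
  have hPcont : Continuous P := B.orthogonalProjectionOnto.continuous
  have hPcoe : ∀ x, (P x : X) = B.starProjection x := fun x => rfl
  have hPm : ∀ p, P (m p) = p := fun p => Subtype.ext (hmP p)
  have hmem : ∀ x, x ∈ Set.range m ↔ m (P x) = x := fun x =>
    ⟨by rintro ⟨p, rfl⟩; rw [hPm], fun hx => ⟨_, hx⟩⟩
  have hgraph : IsConeGraph B V (Set.range m) :=
    ⟨fun p hp => ⟨m ⟨p, hp⟩, ⟨_, rfl⟩, hmP _⟩, by
      rintro _ ⟨p, rfl⟩ _ ⟨q, rfl⟩; exact hmchord p q⟩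
  -- forward invariance
  have hfwd : ∀ t : ℝ, 0 ≤ t → ∀ p, S t (m p) = m (P (S t (m p))) := by
    intro t ht p
    have hG : ∀ j : ℕ, IsConeGraph B V (S j '' B) := fun j =>
      h.isConeGraph_image h.isConeGraph_base (Nat.cast_nonneg j)
    choose g hgG hgP using fun (j : ℕ) => (hG j).exists_over p p.2
    have hR : 0 ≤ 4 * b * (2 * C + b * ‖p‖ ^ 2) / (ε * a) := by positivity
    have hinv : Tendsto (fun j : ℕ => (j : ℝ)⁻¹) atTop (𝓝 0) :=
      tendsto_inv_atTop_zero.comp tendsto_natCast_atTop_atTop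
    have hgm : Tendsto g atTop (𝓝 (m p)) := by
      rw [tendsto_iff_norm_sub_tendsto_zero]
      have h2 : Tendsto (fun j => ‖g j - m p‖ ^ 2) atTop (𝓝 0) := by
        refine squeeze_zero' (Eventually.of_forall fun _ => by positivity) ?_
          (by simpa using hinv.const_mul (4 * b * (2 * C + b * ‖p‖ ^ 2) / (ε * a)))
        filter_upwards [eventually_gt_atTop 0] with j hj
        have hj' : (0 : ℝ) < j := Nat.cast_pos.2 hj
        rw [← div_eq_mul_inv, le_div_iff₀ hj', mul_comm]
        exact hmclose j hj'.le _ (hgG j) p (hgP j)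
      simpa [Real.sqrt_sq] using h2.sqrt
    have hy : Tendsto (fun j => S t (g j)) atTop (𝓝 (S t (m p))) :=
      ((h.continuous ht).tendsto _).comp hgm
    have hPy : Tendsto (fun j => P (S t (g j))) atTop (𝓝 (P (S t (m p)))) :=
      (hPcont.tendsto _).comp hy
    have hmy : Tendsto (fun j => m (P (S t (g j)))) atTop (𝓝 (m (P (S t (m p))))) :=
      (hmcont.tendsto _).comp hPy
    -- `S t (g j)` belongs to the image of the base at time `t + j`, so it approaches the limit
    -- graph over its own moving projection.
    have hdiff : Tendsto (fun j => ‖S t (g j) - m (P (S t (g j)))‖ ^ 2) atTop (𝓝 0) := by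
      have hbd : Tendsto (fun j : ℕ =>
          4 * b * (2 * C + b * ‖P (S t (g j))‖ ^ 2) / (ε * a) * (j : ℝ)⁻¹) atTop
          (𝓝 (4 * b * (2 * C + b * ‖P (S t (m p))‖ ^ 2) / (ε * a) * 0)) :=
        (((((hPy.norm.pow 2).const_mul b).const_add (2 * C)).const_mul (4 * b)).div_const
          (ε * a)).mul hinv
      rw [mul_zero] at hbd
      refine squeeze_zero' (Eventually.of_forall fun _ => by positivity) ?_ hbd
      filter_upwards [eventually_gt_atTop 0] with j hj
      have hj' : (0 : ℝ) < j := Nat.cast_pos.2 hj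
      rw [← div_eq_mul_inv, le_div_iff₀ hj', mul_comm]
      obtain ⟨y, hyB, hy⟩ := hgG j
      refine le_trans ?_ (hmclose (t + j) (by positivity) (S t (g j)) ⟨y, hyB, ?_⟩ _ rfl)
      · gcongr; linarith
      · rw [h.add _ _ _ ht hj'.le, hy]
    have hlim := tendsto_nhds_unique ((hy.sub hmy).norm.pow 2) hdiff
    exact sub_eq_zero.1 (norm_eq_zero.1 (pow_eq_zero_iff two_ne_zero |>.1 hlim))
  have hinvar : ∀ t : ℝ, 0 ≤ t → S t '' Set.range m = Set.range m := by
    intro t ht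
    refine Set.Subset.antisymm ?_ ?_
    · rintro _ ⟨_, ⟨p, rfl⟩, rfl⟩
      exact ⟨_, (hfwd t ht p).symm⟩
    · rintro _ ⟨p, rfl⟩
      -- The image graph meets the fibre over `p`, and forward invariance forces the meeting point
      -- to be `m p`.
      obtain ⟨x, hx, hxp⟩ := (h.isConeGraph_image hgraph ht).exists_over p p.2
      obtain ⟨_, ⟨q, rfl⟩, rfl⟩ := id hx
      have : m p = S t (m q) := by
        rw [hfwd t ht q]; congr 1; exact Subtype.ext hxp.symm
      rwa [this]
  refine ⟨Set.range m, ?_, hinvar, ?_, ?_⟩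
  · have : Set.range m = {x | m (P x) = x} := Set.ext hmem
    rw [this]
    exact isClosed_eq (hmcont.comp hPcont) continuous_id
  · refine ⟨fun p => ⟨m p - p, ?_⟩, ⟨√(b / a), by positivity⟩,
      LipschitzWith.of_dist_le_mul fun p q => ?_, ?_⟩
    · have := Submodule.sub_starProjection_mem_orthogonal (K := B) (m p)
      rwa [hmP] at this
    · rw [dist_eq_norm, dist_eq_norm]
      have h1 := h.norm_sub_proj_le (hmchord p q)
      rw [map_sub, hmP, hmP] at h1
      change ‖(m p - p) - (m q - q)‖ ≤ √(b / a) * ‖(p : X) - q‖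
      convert h1 using 2
      abel
    · congr 1
      ext p
      simp
  · -- exponential tracking with asymptotic phase
    set C₂ := 2 + 3 * c / δ with hC₂
    have hC₂1 : 1 ≤ C₂ := by
      have : 0 ≤ 3 * c / δ := by positivity
      linarith
    -- The summand `1` serves times `t ≤ 1` through the Lipschitz bound; `√(b / ε)` serves later
    -- times through the integral term of `cone`.
    set C₃ := Real.exp θ * Real.exp Λ * (1 + √(b / ε)) * C₂ with hC₃
    have hC₃0 : 0 ≤ C₃ := by positivity
    refine ⟨fun r => C₃ * (‖m 0‖ + (2 + √(b / a)) * r), fun r s hrs => by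
      dsimp only; gcongr, fun ξ₀ => ?_⟩
    -- On the graph, take the trajectory that lies in the fibre of `S j ξ₀` at time `j`. There `V`
    -- of the difference is nonnegative, and by `cone_decay` it was so at all earlier times.
    have hex : ∀ j : ℕ, ∃ p : B, S j (m p) = m (P (S j ξ₀)) := by
      intro j
      have : m (P (S j ξ₀)) ∈ S j '' Set.range m := by
        rw [hinvar j (Nat.cast_nonneg j)]; exact ⟨_, rfl⟩
      obtain ⟨_, ⟨p, rfl⟩, hp⟩ := this
      exact ⟨p, hp⟩
    choose p hp using hex
    set q := ξ₀ - m (P ξ₀) with hq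
    have hVpos : ∀ j : ℕ, 0 ≤ V (S j ξ₀ - S j (m (p j))) := by
      intro j
      have h1 := h.V_lower (S j ξ₀ - S j (m (p j)))
      rw [map_sub, hp, hmP, hPcoe, sub_self] at h1
      simp only [norm_zero] at h1
      rw [hp]
      nlinarith [sq_nonneg ‖S j ξ₀ - m (P (S j ξ₀)) - 0‖]
    have hV0 : ∀ j : ℕ, 0 ≤ V (ξ₀ - m (p j)) := fun j =>
      (mul_nonneg (Real.exp_pos _).le (hVpos j)).trans
        (h.cone_decay (Nat.cast_nonneg j) ξ₀ (m (p j)))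
    -- Here `V (q - d) ≥ 0` while `V d ≤ -δ‖d‖²`, so `V_sub` gives `δ‖d‖² ≤ c‖q‖(‖q‖ + 2‖d‖)`. The
    -- factor 3 comes from the case `‖q‖ ≤ ‖d‖`.
    have hd : ∀ j, ‖m (p j) - m (P ξ₀)‖ ≤ (1 + 3 * c / δ) * ‖q‖ := by
      intro j
      set d := m (p j) - m (P ξ₀) with hd
      have h1 := h.V_sub q d
      have e1 : q - d = ξ₀ - m (p j) := by rw [hq, hd]; abel
      rw [e1] at h1
      have h2 := (hV0 j).trans h1
      have h3 := hmstrict (p j) (P ξ₀)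
      rw [← hd] at h3
      have h4 : 0 ≤ 3 * c / δ := by positivity
      rcases le_total ‖d‖ ‖q‖ with h5 | h5
      · nlinarith [norm_nonneg q, mul_nonneg h4 (norm_nonneg q)]
      · have h6 : δ * ‖d‖ ^ 2 ≤ 3 * c * ‖q‖ * ‖d‖ := by
          nlinarith [mul_nonneg hc (norm_nonneg q),
            mul_le_mul_of_nonneg_left h5 (mul_nonneg hc (norm_nonneg q))]
        rcases (norm_nonneg d).eq_or_lt with h7 | h7
        · rw [← h7]; positivity
        · have h8 : δ * ‖d‖ ≤ 3 * c * ‖q‖ := by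
            refine le_of_mul_le_mul_right ?_ h7
            linarith
          have h9 : ‖d‖ ≤ 3 * c / δ * ‖q‖ := by
            rw [div_mul_eq_mul_div, le_div_iff₀ hδ]; linarith
          linarith [norm_nonneg q]
    have hdq : ∀ j, ‖ξ₀ - m (p j)‖ ≤ C₂ * ‖q‖ := by
      intro j
      have : ξ₀ - m (p j) = q - (m (p j) - m (P ξ₀)) := by rw [hq]; abel
      rw [this]
      refine (norm_sub_le _ _).trans ?_
      have := hd j
      rw [hC₂]; linarith
    have hpt : ∀ t : ℝ, 0 ≤ t → ∀ j : ℕ, t ≤ j →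
        Real.exp (θ * t) * ‖S t ξ₀ - S t (m (p j))‖ ≤ C₃ * ‖q‖ := by
      intro t ht j htj
      rcases le_total t 1 with ht1 | ht1
      · have h1 := h.lip t ξ₀ (m (p j)) ht
        calc Real.exp (θ * t) * ‖S t ξ₀ - S t (m (p j))‖
            ≤ Real.exp θ * (Real.exp Λ * (C₂ * ‖q‖)) := by
              gcongr
              · nlinarith
              · refine h1.trans ?_
                gcongr
                · nlinarith
                · exact hdq j
          _ = Real.exp θ * Real.exp Λ * 1 * C₂ * ‖q‖ := by ring
          _ ≤ _ := by
            rw [hC₃]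
            gcongr
            linarith [Real.sqrt_nonneg (b / ε)]
      · have h1 := h.sq_norm_le_integral ht1 ξ₀ (m (p j))
        have h2 := h.cone t ξ₀ (m (p j)) ht
        have h3 : 0 ≤ V (S t ξ₀ - S t (m (p j))) := by
          have h4 := h.cone_decay (sub_nonneg.2 htj) (S t ξ₀) (S t (m (p j)))
          rw [← h.add _ _ _ (sub_nonneg.2 htj) ht, ← h.add _ _ _ (sub_nonneg.2 htj) ht,
            sub_add_cancel] at h4
          exact (mul_nonneg (Real.exp_pos _).le (hVpos j)).trans h4
        have h5 : V (ξ₀ - m (p j)) ≤ b * (C₂ * ‖q‖) ^ 2 := by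
          have f1 := h.V_upper (ξ₀ - m (p j))
          have f2 : ‖(ξ₀ - m (p j)) - B.starProjection (ξ₀ - m (p j))‖ ≤ ‖ξ₀ - m (p j)‖ := by
            rw [← Submodule.starProjection_orthogonal_val]
            exact Submodule.norm_starProjection_apply_le _ _
          have f3 := pow_le_pow_left₀ (norm_nonneg _) (f2.trans (hdq j)) 2
          nlinarith [sq_nonneg ‖B.starProjection (ξ₀ - m (p j))‖,
            mul_le_mul_of_nonneg_left f3 hb.le]
        have h6 := mul_le_mul_of_nonneg_left h1 hε.le
        have h7 := mul_nonneg (Real.exp_pos (2 * θ * t)).le h3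
        have h8 : ε * (Real.exp (2 * θ * (t - 1)) *
            (Real.exp (-(2 * Λ)) * ‖S t ξ₀ - S t (m (p j))‖ ^ 2)) ≤ b * (C₂ * ‖q‖) ^ 2 := by
          linarith
        refine le_of_sq_le_sq ?_ (by positivity)
        have h9 : (Real.exp (θ * t) * ‖S t ξ₀ - S t (m (p j))‖) ^ 2 =
            (Real.exp θ * Real.exp Λ) ^ 2 * (Real.exp (2 * θ * (t - 1)) *
            (Real.exp (-(2 * Λ)) * ‖S t ξ₀ - S t (m (p j))‖ ^ 2)) := by
          have e1 : Real.exp (θ * t) ^ 2 =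
              (Real.exp θ * Real.exp Λ) ^ 2 * (Real.exp (2 * θ * (t - 1)) *
                Real.exp (-(2 * Λ))) := by
            rw [mul_pow, ← Real.exp_nat_mul, ← Real.exp_nat_mul, ← Real.exp_nat_mul,
              ← Real.exp_add, ← Real.exp_add, ← Real.exp_add]
            push_cast
            ring_nf
          rw [mul_pow, e1]; ring
        have h10 : Real.exp (2 * θ * (t - 1)) *
            (Real.exp (-(2 * Λ)) * ‖S t ξ₀ - S t (m (p j))‖ ^ 2) ≤ b / ε * (C₂ * ‖q‖) ^ 2 := by
          rw [div_mul_eq_mul_div, le_div_iff₀ hε]; linarith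
        rw [h9]
        calc _ ≤ (Real.exp θ * Real.exp Λ) ^ 2 * (b / ε * (C₂ * ‖q‖) ^ 2) := by gcongr
          _ = (Real.exp θ * Real.exp Λ * √(b / ε) * C₂ * ‖q‖) ^ 2 := by
            rw [← Real.sq_sqrt (by positivity : 0 ≤ b / ε)]
            rw [Real.sqrt_sq (Real.sqrt_nonneg _)]
            ring
          _ ≤ _ := by
            rw [hC₃]
            gcongr
            linarith
    have hbdd : Bornology.IsBounded (Metric.closedBall (P ξ₀) ((1 + 3 * c / δ) * ‖q‖)) :=
      Metric.isBounded_closedBall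
    -- The starting points stay in a ball of the finite-dimensional `B`. The bound `hpt` is uniform
    -- in `j ≥ t`, so it survives at a limit point.
    obtain ⟨p₀, -, φ, hφ, hlim⟩ := tendsto_subseq_of_bounded hbdd (x := p) fun j => by
      rw [Metric.mem_closedBall, dist_eq_norm]
      refine le_trans ?_ (hd j)
      have e1 : ((p j - P ξ₀ : B) : X) = B.starProjection (m (p j) - m (P ξ₀)) := by
        rw [map_sub, hmP, hmP]; rfl
      change ‖((p j - P ξ₀ : B) : X)‖ ≤ _
      rw [e1]
      exact Submodule.norm_starProjection_apply_le _ _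
    have hqle : ‖q‖ ≤ ‖m 0‖ + (2 + √(b / a)) * ‖ξ₀‖ := by
      have f1 := hmlip (P ξ₀) 0
      have f2 : ‖P ξ₀ - 0‖ ≤ ‖ξ₀‖ := by
        rw [sub_zero]
        change ‖B.starProjection ξ₀‖ ≤ _
        exact Submodule.norm_starProjection_apply_le _ _
      have f3 : ‖q‖ ≤ ‖ξ₀‖ + ‖m (P ξ₀)‖ := norm_sub_le _ _
      have f4 : ‖m (P ξ₀)‖ ≤ ‖m (P ξ₀) - m 0‖ + ‖m 0‖ := by
        have := norm_add_le (m (P ξ₀) - m 0) (m 0); rwa [sub_add_cancel] at this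
      have f5 := mul_le_mul_of_nonneg_left f2 (by positivity : 0 ≤ 1 + √(b / a))
      linarith
    refine ⟨m p₀, ⟨_, rfl⟩, fun t ht => ?_⟩
    have hfin : Real.exp (θ * t) * ‖S t ξ₀ - S t (m p₀)‖ ≤ C₃ * ‖q‖ := by
      have hl : Tendsto (fun j => Real.exp (θ * t) * ‖S t ξ₀ - S t (m (p (φ j)))‖) atTop
          (𝓝 (Real.exp (θ * t) * ‖S t ξ₀ - S t (m p₀)‖)) :=
        (tendsto_const_nhds.sub
          ((((h.continuous ht).comp hmcont).tendsto p₀).comp hlim)).norm.const_mul _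
      refine le_of_tendsto hl ?_
      obtain ⟨k, hk⟩ := exists_nat_ge t
      filter_upwards [eventually_ge_atTop k] with j hj
      exact hpt t ht _ (hk.trans (Nat.cast_le.2 (hj.trans (hφ.id_le j))))
    have hexp : Real.exp (-θ * t) = (Real.exp (θ * t))⁻¹ := by
      rw [← Real.exp_neg]; ring_nf
    rw [hexp, ← div_eq_mul_inv, le_div_iff₀ (Real.exp_pos _), mul_comm]
    exact hfin.trans (mul_le_mul_of_nonneg_left hqle hC₃0)

end ConeSystem

open MeasureTheory Filter Topology

/-! ### Modal equations and energy estimates. -/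

section Modal

variable {H : Type*} [NormedAddCommGroup H] [InnerProductSpace ℝ H]

theorem hasSum_sq_inner (e : HilbertBasis ℕ ℝ H) (x : H) :
    HasSum (fun k => ⟪x, e k⟫ ^ 2) (‖x‖ ^ 2) := by
  have := e.hasSum_inner_mul_inner x x
  rw [real_inner_self_eq_norm_sq] at this
  refine this.congr_fun fun k => ?_
  rw [sq, real_inner_comm (e k) x]

/-- The coordinates of `(u, v)` solve `u' + λ (u + v) = 0`, `v' + λ v = f`. -/
structure IsModalSolution (e : HilbertBasis ℕ ℝ H) (lam : ℕ → ℝ) (u v f : ℝ → H) : Prop where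
  cont_fst : ContinuousOn u (Set.Ici 0)
  cont_snd : ContinuousOn v (Set.Ici 0)
  cont_force : ContinuousOn f (Set.Ici 0)
  deriv_fst : ∀ k t, 0 ≤ t → HasDerivWithinAt (fun s => ⟪u s, e k⟫)
    (-lam k * (⟪u t, e k⟫ + ⟪v t, e k⟫)) (Set.Ici 0) t
  deriv_snd : ∀ k t, 0 ≤ t → HasDerivWithinAt (fun s => ⟪v s, e k⟫)
    (-lam k * ⟪v t, e k⟫ + ⟪f t, e k⟫) (Set.Ici 0) t

namespace IsModalSolution

variable {e : HilbertBasis ℕ ℝ H} {lam : ℕ → ℝ} {u v f u' v' f' : ℝ → H}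

theorem sub (h : IsModalSolution e lam u v f) (h' : IsModalSolution e lam u' v' f') :
    IsModalSolution e lam (fun t => u t - u' t) (fun t => v t - v' t) (fun t => f t - f' t) where
  cont_fst := h.cont_fst.sub h'.cont_fst
  cont_snd := h.cont_snd.sub h'.cont_snd
  cont_force := h.cont_force.sub h'.cont_force
  deriv_fst k t ht := by
    simp only [inner_sub_left]
    exact ((h.deriv_fst k t ht).sub (h'.deriv_fst k t ht)).congr_deriv (by ring)
  deriv_snd k t ht := by
    simp only [inner_sub_left]
    exact ((h.deriv_snd k t ht).sub (h'.deriv_snd k t ht)).congr_deriv (by ring)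

/-- Summation of a differential inequality that holds in every mode. -/
theorem energy (h : IsModalSolution e lam u v f) {σ p r : ℝ} {α β : ℕ → ℝ} {W : H → H → ℝ}
    (hW : ∀ x y, HasSum (fun k => α k * ⟪x, e k⟫ ^ 2 + β k * ⟪y, e k⟫ ^ 2) (W x y))
    (hmode : ∀ k (x y z : ℝ), σ * (α k * x ^ 2 + β k * y ^ 2) +
      2 * α k * x * (-lam k * (x + y)) + 2 * β k * y * (-lam k * y + z) ≤
        z ^ 2 - p * x ^ 2 - r * y ^ 2) {t : ℝ} (ht : 0 ≤ t) :
    Real.exp (σ * t) * W (u t) (v t) ≤ W (u 0) (v 0) +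
      ∫ s in (0 : ℝ)..t, Real.exp (σ * s) * (‖f s‖ ^ 2 - p * ‖u s‖ ^ 2 - r * ‖v s‖ ^ 2) := by
  have hsub : Set.Icc 0 t ⊆ Set.Ici 0 := fun s hs => hs.1
  have hu := h.cont_fst.mono hsub
  have hv := h.cont_snd.mono hsub
  have hf := h.cont_force.mono hsub
  set g : ℕ → ℝ → ℝ := fun k s =>
    Real.exp (σ * s) * (⟪f s, e k⟫ ^ 2 - p * ⟪u s, e k⟫ ^ 2 - r * ⟪v s, e k⟫ ^ 2) with hg
  have hgc : ∀ k, ContinuousOn (g k) (Set.Icc 0 t) := fun k => by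
    simp only [hg]; fun_prop
  have hsum : HasSum (fun k => ∫ s in (0 : ℝ)..t, g k s) (∫ s in (0 : ℝ)..t,
      Real.exp (σ * s) * (‖f s‖ ^ 2 - p * ‖u s‖ ^ 2 - r * ‖v s‖ ^ 2)) := by
    have hb : ∀ s, HasSum (fun k => Real.exp (σ * s) *
        (⟪f s, e k⟫ ^ 2 + |p| * ⟪u s, e k⟫ ^ 2 + |r| * ⟪v s, e k⟫ ^ 2))
        (Real.exp (σ * s) * (‖f s‖ ^ 2 + |p| * ‖u s‖ ^ 2 + |r| * ‖v s‖ ^ 2)) := fun s =>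
      (((hasSum_sq_inner e (f s)).add ((hasSum_sq_inner e (u s)).mul_left _)).add
        ((hasSum_sq_inner e (v s)).mul_left _)).mul_left _
    refine intervalIntegral.hasSum_integral_of_dominated_convergence
      (fun k s => Real.exp (σ * s) *
        (⟪f s, e k⟫ ^ 2 + |p| * ⟪u s, e k⟫ ^ 2 + |r| * ⟪v s, e k⟫ ^ 2)) ?_ ?_ ?_ ?_ ?_
    · intro k
      rw [Set.uIoc_of_le ht]
      exact ((hgc k).mono Set.Ioc_subset_Icc_self).aestronglyMeasurable measurableSet_Ioc
    · refine fun k => Filter.Eventually.of_forall fun s _ => ?_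
      rw [Real.norm_eq_abs, abs_mul, abs_of_pos (Real.exp_pos _)]
      refine mul_le_mul_of_nonneg_left ?_ (Real.exp_pos _).le
      refine (abs_sub _ _).trans (add_le_add ((abs_sub _ _).trans (add_le_add ?_ ?_)) ?_)
      · rw [abs_of_nonneg (sq_nonneg _)]
      · rw [abs_mul, abs_of_nonneg (sq_nonneg ⟪u s, e k⟫)]
      · rw [abs_mul, abs_of_nonneg (sq_nonneg ⟪v s, e k⟫)]
    · exact Filter.Eventually.of_forall fun s _ => (hb s).summable
    · simp only [fun s => (hb s).tsum_eq]
      apply ContinuousOn.intervalIntegrable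
      rw [Set.uIcc_of_le ht]
      fun_prop
    · exact Filter.Eventually.of_forall fun s _ =>
        (((hasSum_sq_inner e (f s)).sub ((hasSum_sq_inner e (u s)).mul_left _)).sub
          ((hasSum_sq_inner e (v s)).mul_left _)).mul_left _
  -- A solution need not take values in `D(A)`, so the form cannot be differentiated directly. Each
  -- mode is a scalar ODE; its integrated inequality is proved first and the inequalities are then
  -- summed.
  refine hasSum_le (fun k => ?_) ((hW (u t) (v t)).mul_left (Real.exp (σ * t)))
    ((hW (u 0) (v 0)).add hsum)
  set φ : ℝ → ℝ := fun s =>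
    Real.exp (σ * s) * (α k * ⟪u s, e k⟫ ^ 2 + β k * ⟪v s, e k⟫ ^ 2) with hφ
  have key := intervalIntegral.sub_le_integral_of_hasDeriv_right_of_le (g := φ) (φ := g k)
    (g' := fun s => Real.exp (σ * s) * (σ * (α k * ⟪u s, e k⟫ ^ 2 + β k * ⟪v s, e k⟫ ^ 2) +
      2 * α k * ⟪u s, e k⟫ * (-lam k * (⟪u s, e k⟫ + ⟪v s, e k⟫)) +
      2 * β k * ⟪v s, e k⟫ * (-lam k * ⟪v s, e k⟫ + ⟪f s, e k⟫))) ht ?_ ?_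
    ((hgc k).integrableOn_Icc) ?_
  · simp only [hφ, mul_zero, Real.exp_zero, one_mul] at key
    linarith
  · simp only [hφ]; fun_prop
  · intro s hs
    have h1 := (h.deriv_fst k s hs.1.le).mono (fun x hx => hs.1.le.trans (le_of_lt hx) :
      Set.Ioi s ⊆ Set.Ici 0)
    have h2 := (h.deriv_snd k s hs.1.le).mono (fun x hx => hs.1.le.trans (le_of_lt hx) :
      Set.Ioi s ⊆ Set.Ici 0)
    have h3 : HasDerivWithinAt (fun s => Real.exp (σ * s)) (Real.exp (σ * s) * σ)
        (Set.Ioi s) s := by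
      have := ((hasDerivAt_id s).const_mul σ).exp.hasDerivWithinAt (s := Set.Ioi s)
      simpa using this
    refine (h3.mul (((h1.pow 2).const_mul (α k)).add
      ((h2.pow 2).const_mul (β k)))).congr_deriv ?_
    simp only [Nat.cast_ofNat, Nat.add_one_sub_one, pow_one, Pi.add_apply, Pi.pow_apply]
    ring
  · intro s _
    exact mul_le_mul_of_nonneg_left (hmode k _ _ _) (Real.exp_pos _).le

/-- Lipschitz estimate when the force is controlled by the first component. -/
theorem lipschitz_estimate (h : IsModalSolution e lam u v f) (hlam : ∀ k, 0 ≤ lam k) {L : ℝ}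
    (hf : ∀ t, 0 ≤ t → ‖f t‖ ≤ L * ‖u t‖) {t : ℝ} (ht : 0 ≤ t) :
    ‖u t‖ ^ 2 + ‖v t‖ ^ 2 ≤ Real.exp ((1 + L ^ 2) * t) * (‖u 0‖ ^ 2 + ‖v 0‖ ^ 2) := by
  have h1 := h.energy (σ := -(1 + L ^ 2)) (p := L ^ 2) (r := 0) (α := 1) (β := 1)
    (W := fun x y => ‖x‖ ^ 2 + ‖y‖ ^ 2) (fun x y => by
      simpa using (hasSum_sq_inner e x).add (hasSum_sq_inner e y)) (fun k x y z => by
      simp only [Pi.one_apply]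
      nlinarith [sq_nonneg (y - z), mul_nonneg (hlam k) (sq_nonneg (x + y)),
        mul_nonneg (hlam k) (sq_nonneg x), mul_nonneg (hlam k) (sq_nonneg y),
        mul_nonneg (sq_nonneg L) (sq_nonneg y), sq_nonneg x]) ht
  have h2 : (∫ s in (0 : ℝ)..t, Real.exp (-(1 + L ^ 2) * s) *
      (‖f s‖ ^ 2 - L ^ 2 * ‖u s‖ ^ 2 - 0 * ‖v s‖ ^ 2)) ≤ 0 := by
    rw [intervalIntegral.integral_of_le ht]
    refine setIntegral_nonpos measurableSet_Ioc fun s hs => ?_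
    have := pow_le_pow_left₀ (norm_nonneg _) (hf s hs.1.le) 2
    refine mul_nonpos_of_nonneg_of_nonpos (Real.exp_pos _).le ?_
    rw [mul_pow] at this
    linarith
  have h3 : Real.exp ((1 + L ^ 2) * t) * Real.exp (-(1 + L ^ 2) * t) = 1 := by
    rw [← Real.exp_add, ← add_mul, add_neg_cancel, zero_mul, Real.exp_zero]
  calc ‖u t‖ ^ 2 + ‖v t‖ ^ 2 = Real.exp ((1 + L ^ 2) * t) *
        (Real.exp (-(1 + L ^ 2) * t) * (‖u t‖ ^ 2 + ‖v t‖ ^ 2)) := by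
        rw [← mul_assoc, h3, one_mul]
    _ ≤ _ := mul_le_mul_of_nonneg_left (by linarith) (Real.exp_pos _).le

end IsModalSolution

end Modal

/-! ### Multipliers in the eigenbasis. -/

section Diagonal

variable {H : Type*} [NormedAddCommGroup H] [InnerProductSpace ℝ H]

theorem HilbertBasis.ext_inner (e : HilbertBasis ℕ ℝ H) {x y : H}
    (h : ∀ k, ⟪x, e k⟫ = ⟪y, e k⟫) : x = y := by
  apply e.repr.injective
  ext k
  rw [e.repr_apply_apply, e.repr_apply_apply, real_inner_comm, h k, real_inner_comm]

theorem memℓp_mul_inner (e : HilbertBasis ℕ ℝ H) {m : ℕ → ℝ} (hm : ∀ k, |m k| ≤ 1) (x : H) :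
    Memℓp (fun k => m k * ⟪x, e k⟫) 2 := by
  refine memℓp_gen ?_
  refine Summable.of_nonneg_of_le (fun k => by positivity) (fun k => ?_)
    (hasSum_sq_inner e x).summable
  simp only [ENNReal.toReal_ofNat, Real.rpow_ofNat, Real.norm_eq_abs, sq_abs, mul_pow]
  have : m k ^ 2 ≤ 1 := by rw [← sq_abs]; exact pow_le_one₀ (abs_nonneg _) (hm k)
  nlinarith [sq_nonneg ⟪x, e k⟫]

/-- The operator which multiplies the `k`-th coordinate by `m k`, where `|m k| ≤ 1`. -/
noncomputable def diagonalOp (e : HilbertBasis ℕ ℝ H) (m : ℕ → ℝ) (hm : ∀ k, |m k| ≤ 1) (x : H) :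
    H :=
  e.repr.symm ⟨fun k => m k * ⟪x, e k⟫, memℓp_mul_inner e hm x⟩

variable (e : HilbertBasis ℕ ℝ H) {m : ℕ → ℝ} (hm : ∀ k, |m k| ≤ 1)

theorem inner_diagonalOp (x : H) (k : ℕ) : ⟪diagonalOp e m hm x, e k⟫ = m k * ⟪x, e k⟫ := by
  rw [real_inner_comm, ← e.repr_apply_apply, diagonalOp, LinearIsometryEquiv.apply_symm_apply]

theorem diagonalOp_sub (x y : H) :
    diagonalOp e m hm (x - y) = diagonalOp e m hm x - diagonalOp e m hm y :=
  e.ext_inner fun k => by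
    rw [inner_diagonalOp, inner_sub_left, inner_sub_left, inner_diagonalOp, inner_diagonalOp,
      mul_sub]

theorem norm_diagonalOp_le (x : H) : ‖diagonalOp e m hm x‖ ≤ ‖x‖ := by
  refine le_of_sq_le_sq ?_ (norm_nonneg _)
  refine hasSum_le (fun k => ?_) (hasSum_sq_inner e _) (hasSum_sq_inner e x)
  rw [inner_diagonalOp, mul_pow]
  have : m k ^ 2 ≤ 1 := by rw [← sq_abs]; exact pow_le_one₀ (abs_nonneg _) (hm k)
  nlinarith [sq_nonneg ⟪x, e k⟫]

/-- For a fixed vector, continuity in `t` is dominated convergence in Parseval's sum; contractivity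
upgrades it to joint continuity. -/
theorem continuous_diagonalOp {m : ℝ → ℕ → ℝ} (hm : ∀ t k, |m t k| ≤ 1)
    (hc : ∀ k, Continuous fun t => m t k) :
    Continuous fun q : ℝ × H => diagonalOp e (m q.1) (hm q.1) q.2 := by
  rw [continuous_iff_continuousAt]
  rintro ⟨t₀, x₀⟩
  have h1 : Tendsto (fun t => ‖diagonalOp e (m t) (hm t) x₀ -
      diagonalOp e (m t₀) (hm t₀) x₀‖ ^ 2) (𝓝 t₀) (𝓝 0) := by
    have h2 : ∀ t, ‖diagonalOp e (m t) (hm t) x₀ - diagonalOp e (m t₀) (hm t₀) x₀‖ ^ 2 =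
        ∑' k, ((m t k - m t₀ k) * ⟪x₀, e k⟫) ^ 2 := fun t => by
      rw [← (hasSum_sq_inner e _).tsum_eq]
      congr 1 with k
      rw [inner_sub_left, inner_diagonalOp, inner_diagonalOp, sub_mul]
    simp only [h2]
    have h3 : (0 : ℝ) = ∑' k, ((m t₀ k - m t₀ k) * ⟪x₀, e k⟫) ^ 2 := by simp
    rw [h3]
    refine tendsto_tsum_of_dominated_convergence (bound := fun k => 4 * ⟪x₀, e k⟫ ^ 2)
      ((hasSum_sq_inner e x₀).summable.mul_left 4) (fun k => ?_) ?_
    · have := (((hc k).tendsto t₀).sub_const (m t₀ k)).mul_const ⟪x₀, e k⟫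
      exact this.pow 2
    · refine Eventually.of_forall fun t k => ?_
      rw [Real.norm_eq_abs, abs_of_nonneg (sq_nonneg _), mul_pow]
      have h4 : |m t k - m t₀ k| ≤ 2 :=
        (abs_sub _ _).trans (by linarith [hm t k, hm t₀ k])
      have h5 : (m t k - m t₀ k) ^ 2 ≤ 4 := by
        rw [← sq_abs]
        nlinarith [abs_nonneg (m t k - m t₀ k)]
      exact mul_le_mul_of_nonneg_right h5 (sq_nonneg _)
  have h1' : Tendsto (fun t => ‖diagonalOp e (m t) (hm t) x₀ -
      diagonalOp e (m t₀) (hm t₀) x₀‖) (𝓝 t₀) (𝓝 0) := by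
    simpa [Real.sqrt_sq] using h1.sqrt
  rw [ContinuousAt, tendsto_iff_norm_sub_tendsto_zero]
  have h6 : Tendsto (fun q : ℝ × H => ‖q.2 - x₀‖ + ‖diagonalOp e (m q.1) (hm q.1) x₀ -
      diagonalOp e (m t₀) (hm t₀) x₀‖) (𝓝 (t₀, x₀)) (𝓝 (0 + 0)) := by
    refine Tendsto.add ?_ (h1'.comp (continuous_fst.tendsto (t₀, x₀)))
    have : Continuous fun q : ℝ × H => ‖q.2 - x₀‖ := by fun_prop
    simpa using this.tendsto (t₀, x₀)
  rw [add_zero] at h6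
  refine squeeze_zero (fun _ => norm_nonneg _) (fun q => ?_) h6
  have : diagonalOp e (m q.1) (hm q.1) q.2 - diagonalOp e (m t₀) (hm t₀) x₀ =
      diagonalOp e (m q.1) (hm q.1) (q.2 - x₀) +
      (diagonalOp e (m q.1) (hm q.1) x₀ - diagonalOp e (m t₀) (hm t₀) x₀) := by
    rw [diagonalOp_sub]; abel
  rw [this]
  exact (norm_add_le _ _).trans (add_le_add_left (norm_diagonalOp_le _ _ _) _)

end Diagonal

/-! ### A Volterra equation solved in an exponentially weighted norm. -/

section Volterra

variable {H : Type*} [NormedAddCommGroup H] [NormedSpace ℝ H]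

/-- Integration against the weight `e^{μs}` gains `1 / μ`; this makes the Volterra map a contraction
for large `μ`. -/
theorem exp_mul_norm_integral_le {μ K t : ℝ} (hμ : 0 < μ) (hK : 0 ≤ K) (ht : 0 ≤ t) {y : ℝ → H}
    (hy : ∀ s ∈ Set.Icc 0 t, ‖y s‖ ≤ K * Real.exp (μ * s)) :
    Real.exp (-(μ * t)) * ‖∫ s in (0 : ℝ)..t, y s‖ ≤ K / μ := by
  have h1 : ‖∫ s in (0 : ℝ)..t, y s‖ ≤ ∫ s in (0 : ℝ)..t, K * Real.exp (μ * s) :=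
    intervalIntegral.norm_integral_le_of_norm_le ht
      (Eventually.of_forall fun s hs => hy s ⟨hs.1.le, hs.2⟩)
      ((by fun_prop : Continuous fun s => K * Real.exp (μ * s)).intervalIntegrable _ _)
  have h2 : (∫ s in (0 : ℝ)..t, K * Real.exp (μ * s)) =
      K / μ * Real.exp (μ * t) - K / μ * Real.exp (μ * 0) := by
    refine intervalIntegral.integral_eq_sub_of_hasDerivAt
      (f := fun s => K / μ * Real.exp (μ * s)) (fun s _ => ?_)
      ((by fun_prop : Continuous fun s => K * Real.exp (μ * s)).intervalIntegrable _ _)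
    refine (((hasDerivAt_id s).const_mul μ).exp.const_mul (K / μ)).congr_deriv ?_
    simp only [id, mul_one]
    field_simp
  rw [h2] at h1
  have h3 : 0 ≤ K / μ * Real.exp (μ * 0) := by positivity
  calc Real.exp (-(μ * t)) * ‖∫ s in (0 : ℝ)..t, y s‖
      ≤ Real.exp (-(μ * t)) * (K / μ * Real.exp (μ * t)) := by
        gcongr; linarith
    _ = K / μ * (Real.exp (-(μ * t)) * Real.exp (μ * t)) := by ring
    _ = K / μ := by rw [← Real.exp_add]; simp

variable [CompleteSpace H]

/-- Solvability of a Volterra equation with a strongly continuous contractive kernel. -/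
theorem exists_volterra_solution {T : ℝ → H → H} (hT : Continuous (Function.uncurry T))
    (hTn : ∀ t x, ‖T t x‖ ≤ ‖x‖) (hTs : ∀ t x y, T t (x - y) = T t x - T t y)
    {g : ℝ → H} (hg : Continuous g) {R : ℝ} (hR : ∀ t, ‖g t‖ ≤ R)
    {F : H → H} {L : ℝ≥0} (hF : LipschitzWith L F) :
    ∃ u : ℝ → H, Continuous u ∧
      ∀ t, 0 ≤ t → u t = g t - ∫ s in (0 : ℝ)..t, T (t - s) (F (u s)) := by
  -- This choice gives `L / μ ≤ 1 / 2`. The unknown is `w = e^{-μt}u`, and `max t 0` extends the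
  -- equation to negative times so that `w` can range over bounded continuous functions on `ℝ`.
  set μ : ℝ := 2 * L + 1 with hμ
  have hL : (0 : ℝ) ≤ L := L.2
  have hμ0 : 0 < μ := by positivity
  have hFc := hF.continuous
  have hlin : ∀ x, ‖F x‖ ≤ ‖F 0‖ + L * ‖x‖ := fun x => by
    have h1 := hF.norm_sub_le x 0
    have h2 := norm_add_le (F x - F 0) (F 0)
    rw [sub_add_cancel] at h2
    rw [sub_zero] at h1
    linarith
  set I : BoundedContinuousFunction ℝ H → ℝ → H := fun w t =>
    ∫ s in (0 : ℝ)..(max t 0), T (max t 0 - s) (F (Real.exp (μ * s) • w s)) with hI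
  have hIc : ∀ w, Continuous (I w) := fun w => by
    have hcont : Continuous (Function.uncurry fun (t s : ℝ) =>
        T (max t 0 - s) (F (Real.exp (μ * s) • w s))) :=
      hT.comp (by fun_prop : Continuous fun q : ℝ × ℝ =>
        (max q.1 0 - q.2, F (Real.exp (μ * q.2) • w q.2)))
    exact intervalIntegral.continuous_parametric_intervalIntegral_of_continuous hcont
      (by fun_prop)
  have hbd : ∀ w t, ‖Real.exp (-(μ * max t 0)) • (g (max t 0) - I w t)‖ ≤
      R + (‖F 0‖ + L * ‖w‖) / μ := by
    intro w t
    have ht : 0 ≤ max t 0 := le_max_right _ _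
    rw [smul_sub]
    refine (norm_sub_le _ _).trans (add_le_add ?_ ?_)
    · rw [norm_smul, Real.norm_eq_abs, abs_of_pos (Real.exp_pos _)]
      have h1 : Real.exp (-(μ * max t 0)) ≤ 1 := Real.exp_le_one_iff.2 (by
        have := mul_nonneg hμ0.le ht; linarith)
      nlinarith [hR (max t 0), norm_nonneg (g (max t 0))]
    · rw [norm_smul, Real.norm_eq_abs, abs_of_pos (Real.exp_pos _)]
      refine exp_mul_norm_integral_le hμ0 (by positivity) ht fun s hs => ?_
      refine (hTn _ _).trans ((hlin _).trans ?_)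
      rw [norm_smul, Real.norm_eq_abs, abs_of_pos (Real.exp_pos _)]
      have h2 : 1 ≤ Real.exp (μ * s) := Real.one_le_exp (mul_nonneg hμ0.le hs.1)
      have h3 := w.norm_coe_le_norm s
      calc ‖F 0‖ + L * (Real.exp (μ * s) * ‖w s‖)
          ≤ ‖F 0‖ * Real.exp (μ * s) + L * (Real.exp (μ * s) * ‖w‖) := by
            gcongr
            exact le_mul_of_one_le_right (norm_nonneg _) h2
        _ = _ := by ring
  let Φ : BoundedContinuousFunction ℝ H → BoundedContinuousFunction ℝ H := fun w =>
    BoundedContinuousFunction.ofNormedAddCommGroup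
      (fun t => Real.exp (-(μ * max t 0)) • (g (max t 0) - I w t))
      (by have := hIc w; fun_prop) _ (hbd w)
  have hΦ : ContractingWith (1 / 2 : ℝ≥0) Φ := by
    refine ⟨by rw [← NNReal.coe_lt_coe]; norm_num, LipschitzWith.of_dist_le_mul fun w w' => ?_⟩
    rw [dist_eq_norm, dist_eq_norm]
    refine (BoundedContinuousFunction.norm_le (by positivity)).2 fun t => ?_
    have ht : 0 ≤ max t 0 := le_max_right _ _
    have hint : ∀ w : BoundedContinuousFunction ℝ H, IntervalIntegrable
        (fun s => T (max t 0 - s) (F (Real.exp (μ * s) • w s))) volume 0 (max t 0) := fun w =>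
      (hT.comp (by fun_prop : Continuous fun s : ℝ =>
        (max t 0 - s, F (Real.exp (μ * s) • w s)))).intervalIntegrable _ _
    have h1 : (Φ w - Φ w') t = -(Real.exp (-(μ * max t 0)) •
        ∫ s in (0 : ℝ)..(max t 0), (T (max t 0 - s) (F (Real.exp (μ * s) • w s)) -
          T (max t 0 - s) (F (Real.exp (μ * s) • w' s)))) := by
      rw [intervalIntegral.integral_sub (hint w) (hint w')]
      change Real.exp (-(μ * max t 0)) • (g (max t 0) - I w t) -
        Real.exp (-(μ * max t 0)) • (g (max t 0) - I w' t) = _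
      rw [← smul_sub, ← smul_neg]
      congr 1
      simp only [hI]
      abel
    rw [h1, norm_neg, norm_smul, Real.norm_eq_abs, abs_of_pos (Real.exp_pos _)]
    refine (exp_mul_norm_integral_le (K := L * ‖w - w'‖) hμ0 (by positivity) ht
      fun s hs => ?_).trans ?_
    · rw [← hTs]
      refine (hTn _ _).trans ((hF.norm_sub_le _ _).trans ?_)
      rw [← smul_sub, norm_smul, Real.norm_eq_abs, abs_of_pos (Real.exp_pos _)]
      have := (w - w').norm_coe_le_norm s
      calc (L : ℝ) * (Real.exp (μ * s) * ‖w s - w' s‖)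
          ≤ L * (Real.exp (μ * s) * ‖w - w'‖) := by gcongr; exact this
        _ = _ := by ring
    · rw [div_le_iff₀ hμ0, hμ]
      push_cast
      nlinarith [norm_nonneg (w - w')]
  have hfix : Φ (ContractingWith.fixedPoint Φ hΦ) = _ := hΦ.fixedPoint_isFixedPt
  set w := ContractingWith.fixedPoint Φ hΦ
  refine ⟨fun t => Real.exp (μ * t) • w t, by fun_prop, fun t ht => ?_⟩
  have h1 : w t = Real.exp (-(μ * max t 0)) • (g (max t 0) - I w t) := by
    conv_lhs => rw [← hfix]
    rfl
  simp only [hI, max_eq_left ht] at h1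
  change Real.exp (μ * t) • w t = _
  rw [h1, smul_smul, ← Real.exp_add, add_neg_cancel, Real.exp_zero, one_smul]

end Volterra

/-! ### Mild solutions by variation of constants. -/

section Existence

variable {H : Type*} [NormedAddCommGroup H] [InnerProductSpace ℝ H]

/-- The multipliers of the semigroup generated by `-A`. -/
noncomputable def heatSymbol (lam : ℕ → ℝ) (t : ℝ) (k : ℕ) : ℝ := Real.exp (-(lam k * max t 0))

/-- The multipliers of `t A` times the semigroup generated by `-A`. -/
noncomputable def jordanSymbol (lam : ℕ → ℝ) (t : ℝ) (k : ℕ) : ℝ :=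
  lam k * max t 0 * Real.exp (-(lam k * max t 0))

theorem abs_heatSymbol_le {lam : ℕ → ℝ} (hlam : ∀ k, 0 ≤ lam k) (t : ℝ) (k : ℕ) :
    |heatSymbol lam t k| ≤ 1 := by
  rw [heatSymbol, abs_of_pos (Real.exp_pos _), Real.exp_le_one_iff]
  have := mul_nonneg (hlam k) (le_max_right t 0)
  linarith

/-- Since `s e^{-s} ≤ 1`, the off-diagonal block `tA e^{-tA}` of the linear semigroup is a
contraction although `A` is unbounded. -/
theorem abs_jordanSymbol_le {lam : ℕ → ℝ} (hlam : ∀ k, 0 ≤ lam k) (t : ℝ) (k : ℕ) :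
    |jordanSymbol lam t k| ≤ 1 := by
  have h := mul_nonneg (hlam k) (le_max_right t 0)
  rw [jordanSymbol, abs_of_nonneg (mul_nonneg h (Real.exp_pos _).le), Real.exp_neg,
    ← div_eq_mul_inv, div_le_one (Real.exp_pos _)]
  linarith [Real.add_one_le_exp (lam k * max t 0)]

theorem continuous_heatSymbol (lam : ℕ → ℝ) (k : ℕ) : Continuous fun t => heatSymbol lam t k := by
  unfold heatSymbol; fun_prop

theorem continuous_jordanSymbol (lam : ℕ → ℝ) (k : ℕ) :
    Continuous fun t => jordanSymbol lam t k := by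
  unfold jordanSymbol; fun_prop

theorem inner_intervalIntegral [CompleteSpace H] {f : ℝ → H} (hf : Continuous f) (w : H) (t : ℝ) :
    ⟪∫ s in (0 : ℝ)..t, f s, w⟫ = ∫ s in (0 : ℝ)..t, ⟪f s, w⟫ := by
  have := (innerSL ℝ w).intervalIntegral_comp_comm (hf.intervalIntegrable 0 t) (μ := volume)
  simp only [innerSL_apply_apply] at this
  rw [real_inner_comm, ← this]
  simp only [real_inner_comm]

/-- Scalar variation of constants for the second component. -/
theorem hasDerivWithinAt_duhamel_snd {l y₀ : ℝ} {y φ : ℝ → ℝ} (hφ : Continuous φ)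
    (hy : ∀ t, 0 ≤ t → y t = Real.exp (-(l * t)) * y₀ +
      ∫ s in (0 : ℝ)..t, Real.exp (-(l * (t - s))) * φ s) {t : ℝ} (ht : 0 ≤ t) :
    HasDerivWithinAt y (-l * y t + φ t) (Set.Ici 0) t := by
  have hfac : ∀ t, 0 ≤ t → y t = Real.exp (-(l * t)) *
      (y₀ + ∫ s in (0 : ℝ)..t, Real.exp (l * s) * φ s) := by
    intro t ht
    rw [hy t ht, mul_add, ← intervalIntegral.integral_const_mul]
    congr 2 with s
    rw [← mul_assoc, ← Real.exp_add]
    ring_nf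
  have hd : HasDerivAt (fun t => Real.exp (-(l * t)) *
      (y₀ + ∫ s in (0 : ℝ)..t, Real.exp (l * s) * φ s)) (-l * y t + φ t) t := by
    have h1 : HasDerivAt (fun t => ∫ s in (0 : ℝ)..t, Real.exp (l * s) * φ s)
        (Real.exp (l * t) * φ t) t :=
      (by fun_prop : Continuous fun s => Real.exp (l * s) * φ s).integral_hasStrictDerivAt 0 t
        |>.hasDerivAt
    have h2 : HasDerivAt (fun t => Real.exp (-(l * t))) (Real.exp (-(l * t)) * -l) t := by
      simpa using ((hasDerivAt_id t).const_mul l).neg.exp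
    refine (h2.mul (h1.const_add y₀)).congr_deriv ?_
    rw [hfac t ht]
    have h3 : Real.exp (-(l * t)) * Real.exp (l * t) = 1 := by rw [← Real.exp_add]; simp
    linear_combination φ t * h3
  exact hd.hasDerivWithinAt.congr hfac (hfac t ht)

/-- Scalar variation of constants for the first component. -/
theorem hasDerivWithinAt_duhamel_fst {l x₀ y₀ : ℝ} {x y φ : ℝ → ℝ} (hφ : Continuous φ)
    (hy : ∀ t, 0 ≤ t → y t = Real.exp (-(l * t)) * y₀ +
      ∫ s in (0 : ℝ)..t, Real.exp (-(l * (t - s))) * φ s)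
    (hx : ∀ t, 0 ≤ t → x t = Real.exp (-(l * t)) * x₀ - l * t * Real.exp (-(l * t)) * y₀ -
      ∫ s in (0 : ℝ)..t, l * (t - s) * Real.exp (-(l * (t - s))) * φ s) {t : ℝ} (ht : 0 ≤ t) :
    HasDerivWithinAt x (-l * (x t + y t)) (Set.Ici 0) t := by
  have hyfac : ∀ t, 0 ≤ t → y t = Real.exp (-(l * t)) *
      (y₀ + ∫ s in (0 : ℝ)..t, Real.exp (l * s) * φ s) := by
    intro t ht
    rw [hy t ht, mul_add, ← intervalIntegral.integral_const_mul]
    congr 2 with s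
    rw [← mul_assoc, ← Real.exp_add]
    ring_nf
  have hfac : ∀ t, 0 ≤ t → x t = Real.exp (-(l * t)) *
      (x₀ - l * t * y₀ - (l * t * (∫ s in (0 : ℝ)..t, Real.exp (l * s) * φ s) -
        l * ∫ s in (0 : ℝ)..t, s * Real.exp (l * s) * φ s)) := by
    intro t ht
    rw [hx t ht, ← intervalIntegral.integral_const_mul, ← intervalIntegral.integral_const_mul,
      ← intervalIntegral.integral_sub (Continuous.intervalIntegrable (by fun_prop) _ _)
        (Continuous.intervalIntegrable (by fun_prop) _ _), mul_sub,
      ← intervalIntegral.integral_const_mul]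
    congr 1
    · ring
    · congr 1 with s
      have : Real.exp (-(l * (t - s))) = Real.exp (-(l * t)) * Real.exp (l * s) := by
        rw [← Real.exp_add]; ring_nf
      rw [this]; ring
  have hd : HasDerivAt (fun t => Real.exp (-(l * t)) *
      (x₀ - l * t * y₀ - (l * t * (∫ s in (0 : ℝ)..t, Real.exp (l * s) * φ s) -
        l * ∫ s in (0 : ℝ)..t, s * Real.exp (l * s) * φ s))) (-l * (x t + y t)) t := by
    have h0 : HasDerivAt (fun t => ∫ s in (0 : ℝ)..t, Real.exp (l * s) * φ s)
        (Real.exp (l * t) * φ t) t :=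
      (by fun_prop : Continuous fun s => Real.exp (l * s) * φ s).integral_hasStrictDerivAt 0 t
        |>.hasDerivAt
    have h1 : HasDerivAt (fun t => ∫ s in (0 : ℝ)..t, s * Real.exp (l * s) * φ s)
        (t * Real.exp (l * t) * φ t) t :=
      (by fun_prop : Continuous fun s => s * Real.exp (l * s) * φ s).integral_hasStrictDerivAt 0 t
        |>.hasDerivAt
    have h2 : HasDerivAt (fun t => Real.exp (-(l * t))) (Real.exp (-(l * t)) * -l) t := by
      simpa using ((hasDerivAt_id t).const_mul l).neg.exp
    have h3 : HasDerivAt (fun t => l * t) l t := by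
      simpa using (hasDerivAt_id t).const_mul l
    refine (h2.mul (((h3.mul_const y₀).const_sub x₀).sub
      ((h3.mul h0).sub (h1.const_mul l)))).congr_deriv ?_
    rw [hfac t ht, hyfac t ht]
    simp only [Pi.sub_apply, Pi.mul_apply]
    ring
  exact hd.hasDerivWithinAt.congr hfac (hfac t ht)

variable [CompleteSpace H]

/-- Global solvability of the system, in coordinates. -/
theorem exists_isModalSolution (e : HilbertBasis ℕ ℝ H) {lam : ℕ → ℝ} (hlam : ∀ k, 0 ≤ lam k)
    {F : H → H} {L : ℝ≥0} (hF : LipschitzWith L F) (u₀ v₀ : H) :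
    ∃ u v : ℝ → H, Continuous u ∧ Continuous v ∧ u 0 = u₀ ∧ v 0 = v₀ ∧
      IsModalSolution e lam u v (fun t => F (u t)) := by
  set E : ℝ → H → H := fun t => diagonalOp e (heatSymbol lam t) (abs_heatSymbol_le hlam t) with hE
  set J : ℝ → H → H := fun t => diagonalOp e (jordanSymbol lam t) (abs_jordanSymbol_le hlam t)
    with hJ
  have hEc : Continuous (Function.uncurry E) :=
    continuous_diagonalOp e (abs_heatSymbol_le hlam) (continuous_heatSymbol lam)
  have hJc : Continuous (Function.uncurry J) :=
    continuous_diagonalOp e (abs_jordanSymbol_le hlam) (continuous_jordanSymbol lam)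
  have hEi : ∀ t x k, 0 ≤ t → ⟪E t x, e k⟫ = Real.exp (-(lam k * t)) * ⟪x, e k⟫ :=
    fun t x k ht => by rw [hE, inner_diagonalOp, heatSymbol, max_eq_left ht]
  have hJi : ∀ t x k, 0 ≤ t → ⟪J t x, e k⟫ = lam k * t * Real.exp (-(lam k * t)) * ⟪x, e k⟫ :=
    fun t x k ht => by rw [hJ, inner_diagonalOp, jordanSymbol, max_eq_left ht]
  have hEx : ∀ x, Continuous fun t => E t x := fun x =>
    hEc.comp (by fun_prop : Continuous fun t : ℝ => (t, x))
  have hJx : ∀ x, Continuous fun t => J t x := fun x =>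
    hJc.comp (by fun_prop : Continuous fun t : ℝ => (t, x))
  -- The force depends on `u` alone, so after elimination of `v` the variation of constants formula
  -- is a closed equation for `u`; `v` is then given explicitly.
  obtain ⟨u, hu, hueq⟩ := exists_volterra_solution hJc (fun t x => norm_diagonalOp_le e _ x)
    (fun t x y => diagonalOp_sub e _ x y) (g := fun t => E t u₀ - J t v₀) ((hEx u₀).sub (hJx v₀)) (R := ‖u₀‖ + ‖v₀‖)
    (fun t => (norm_sub_le _ _).trans
      (add_le_add (norm_diagonalOp_le e _ _) (norm_diagonalOp_le e _ _))) hF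
  have hFc := hF.continuous
  have hf : Continuous fun t => F (u t) := hFc.comp hu
  set v : ℝ → H := fun t => E t v₀ + ∫ s in (0 : ℝ)..t, E (t - s) (F (u s)) with hv
  have hvc : Continuous v := by
    have hcont : Continuous (Function.uncurry fun (t s : ℝ) => E (t - s) (F (u s))) :=
      hEc.comp (by fun_prop : Continuous fun q : ℝ × ℝ => (q.1 - q.2, F (u q.2)))
    exact (hEx v₀).add
      (intervalIntegral.continuous_parametric_intervalIntegral_of_continuous hcont continuous_id)
  have hvk : ∀ k t, 0 ≤ t → ⟪v t, e k⟫ = Real.exp (-(lam k * t)) * ⟪v₀, e k⟫ +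
      ∫ s in (0 : ℝ)..t, Real.exp (-(lam k * (t - s))) * ⟪F (u s), e k⟫ := by
    intro k t ht
    rw [hv]
    simp only []
    rw [inner_add_left, hEi _ _ _ ht, inner_intervalIntegral
      (f := fun s => E (t - s) (F (u s))) (hEc.comp (by fun_prop : Continuous fun s : ℝ => (t - s, F (u s))))]
    congr 1
    refine intervalIntegral.integral_congr fun s hs => ?_
    rw [Set.uIcc_of_le ht] at hs
    exact hEi _ _ _ (sub_nonneg.2 hs.2)
  have huk : ∀ k t, 0 ≤ t → ⟪u t, e k⟫ = Real.exp (-(lam k * t)) * ⟪u₀, e k⟫ -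
      lam k * t * Real.exp (-(lam k * t)) * ⟪v₀, e k⟫ -
      ∫ s in (0 : ℝ)..t, lam k * (t - s) * Real.exp (-(lam k * (t - s))) * ⟪F (u s), e k⟫ := by
    intro k t ht
    rw [hueq t ht, inner_sub_left, inner_sub_left, hEi _ _ _ ht, hJi _ _ _ ht,
      inner_intervalIntegral (f := fun s => J (t - s) (F (u s)))
        (hJc.comp (by fun_prop : Continuous fun s : ℝ => (t - s, F (u s))))]
    congr 1
    refine intervalIntegral.integral_congr fun s hs => ?_
    rw [Set.uIcc_of_le ht] at hs
    exact hJi _ _ _ (sub_nonneg.2 hs.2)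
  refine ⟨u, v, hu, hvc, e.ext_inner fun k => by simp [huk k 0 le_rfl],
    e.ext_inner fun k => by simp [hvk k 0 le_rfl], hu.continuousOn, hvc.continuousOn,
    hf.continuousOn, fun k t ht => ?_, fun k t ht => ?_⟩
  · exact hasDerivWithinAt_duhamel_fst (by fun_prop) (hvk k) (huk k) ht
  · exact hasDerivWithinAt_duhamel_snd (by fun_prop) (hvk k) ht

end Existence

/-! ### From modal to weak solutions, and the solution semigroup. -/

section Semigroup

theorem PhaseSpace.norm_sq {H : Type*} [NormedAddCommGroup H] (ξ : PhaseSpace H) : ‖ξ‖ ^ 2 = ‖ξ.fst‖ ^ 2 + ‖ξ.snd‖ ^ 2 :=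
  WithLp.prod_norm_sq_eq_of_L2 ξ

theorem PhaseSpace.norm_fst_le {H : Type*} [NormedAddCommGroup H] (ξ : PhaseSpace H) :
    ‖ξ.fst‖ ≤ ‖ξ‖ :=
  le_of_sq_le_sq (by rw [PhaseSpace.norm_sq ξ]; nlinarith [sq_nonneg ‖ξ.snd‖]) (norm_nonneg _)

theorem PhaseSpace.norm_snd_le {H : Type*} [NormedAddCommGroup H] (ξ : PhaseSpace H) :
    ‖ξ.snd‖ ≤ ‖ξ‖ :=
  le_of_sq_le_sq (by rw [PhaseSpace.norm_sq ξ]; nlinarith [sq_nonneg ‖ξ.fst‖]) (norm_nonneg _)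

variable {H : Type*} [NormedAddCommGroup H] [InnerProductSpace ℝ H]
  {A : H →ₗ.[ℝ] H} {lam : ℕ → ℝ} {e : HilbertBasis ℕ ℝ H}

theorem IsSolution.isModalSolution (he : IsEigenbasis A lam e) {F : H → H} (hF : Continuous F)
    {ξ : ℝ → PhaseSpace H} (h : IsSolution A F ξ) :
    IsModalSolution e lam (fun t => (ξ t).fst) (fun t => (ξ t).snd) (fun t => F (ξ t).fst) where
  cont_fst := (WithLp.continuous_fst 2 H H).comp_continuousOn h.continuousOn
  cont_snd := (WithLp.continuous_snd 2 H H).comp_continuousOn h.continuousOn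
  cont_force := hF.comp_continuousOn
    ((WithLp.continuous_fst 2 H H).comp_continuousOn h.continuousOn)
  deriv_fst k t ht := by
    obtain ⟨x, hx, hAx⟩ := he.eigen k
    have := h.eq_fst x t ht
    rw [hAx, hx, inner_smul_right, inner_smul_right] at this
    exact this.congr_deriv (by ring)
  deriv_snd k t ht := by
    obtain ⟨x, hx, hAx⟩ := he.eigen k
    have := h.eq_snd x t ht
    rw [hAx, hx, inner_smul_right] at this
    exact this.congr_deriv (by ring)

/-- Summation of the modal equations against a test vector. -/
theorem hasDerivWithinAt_inner_of_modes (e : HilbertBasis ℕ ℝ H) {y a b : ℝ → H}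
    (hy : Continuous y) (ha : Continuous a) (hb : Continuous b) {w w₁ w₂ : H} {c : ℕ → ℝ → ℝ}
    (hd : ∀ k t, 0 ≤ t → HasDerivWithinAt (fun s => ⟪y s, e k⟫) (c k t) (Set.Ici 0) t)
    (hc : ∀ k t, c k t * ⟪w, e k⟫ = ⟪a t, e k⟫ * ⟪w₁, e k⟫ + ⟪b t, e k⟫ * ⟪w₂, e k⟫)
    {t : ℝ} (ht : 0 ≤ t) :
    HasDerivWithinAt (fun s => ⟪y s, w⟫) (⟪a t, w₁⟫ + ⟪b t, w₂⟫) (Set.Ici 0) t := by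
  have hpar : ∀ x z : H, HasSum (fun k => ⟪x, e k⟫ * ⟪z, e k⟫) ⟪x, z⟫ := fun x z =>
    (e.hasSum_inner_mul_inner x z).congr_fun fun k => by rw [real_inner_comm (e k) z]
  have hgc : Continuous fun t => ⟪a t, w₁⟫ + ⟪b t, w₂⟫ := by fun_prop
  -- The modal derivatives are summed in integrated form, where dominated convergence applies; the
  -- continuous integrand then gives back the derivative.
  have hint : ∀ t, 0 ≤ t → ⟪y t, w⟫ = ⟪y 0, w⟫ + ∫ s in (0 : ℝ)..t, (⟪a s, w₁⟫ + ⟪b s, w₂⟫) := by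
    intro t ht
    have hsum : HasSum (fun k => ∫ s in (0 : ℝ)..t,
        (⟪a s, e k⟫ * ⟪w₁, e k⟫ + ⟪b s, e k⟫ * ⟪w₂, e k⟫))
        (∫ s in (0 : ℝ)..t, (⟪a s, w₁⟫ + ⟪b s, w₂⟫)) := by
      have hbd : ∀ s, HasSum (fun k => ((⟪a s, e k⟫ ^ 2 + ⟪w₁, e k⟫ ^ 2) +
          (⟪b s, e k⟫ ^ 2 + ⟪w₂, e k⟫ ^ 2)))
          ((‖a s‖ ^ 2 + ‖w₁‖ ^ 2) + (‖b s‖ ^ 2 + ‖w₂‖ ^ 2)) := fun s =>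
        ((hasSum_sq_inner e _).add (hasSum_sq_inner e _)).add
          ((hasSum_sq_inner e _).add (hasSum_sq_inner e _))
      refine intervalIntegral.hasSum_integral_of_dominated_convergence
        (fun k s => ((⟪a s, e k⟫ ^ 2 + ⟪w₁, e k⟫ ^ 2) + (⟪b s, e k⟫ ^ 2 + ⟪w₂, e k⟫ ^ 2)))
        (fun k => (by fun_prop : Continuous fun s =>
          ⟪a s, e k⟫ * ⟪w₁, e k⟫ + ⟪b s, e k⟫ * ⟪w₂, e k⟫).aestronglyMeasurable) ?_
        (Eventually.of_forall fun s _ => (hbd s).summable) ?_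
        (Eventually.of_forall fun s _ => (hpar _ _).add (hpar _ _))
      · refine fun k => Eventually.of_forall fun s _ => (norm_add_le _ _).trans ?_
        rw [Real.norm_eq_abs, Real.norm_eq_abs]
        refine add_le_add ?_ ?_ <;> rw [abs_le] <;> constructor <;>
          nlinarith [sq_nonneg (⟪a s, e k⟫ + ⟪w₁, e k⟫), sq_nonneg (⟪a s, e k⟫ - ⟪w₁, e k⟫),
            sq_nonneg (⟪b s, e k⟫ + ⟪w₂, e k⟫), sq_nonneg (⟪b s, e k⟫ - ⟪w₂, e k⟫)]
      · simp only [fun s => (hbd s).tsum_eq]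
        exact Continuous.intervalIntegrable (by fun_prop) _ _
    have hk : ∀ k, (∫ s in (0 : ℝ)..t, (⟪a s, e k⟫ * ⟪w₁, e k⟫ + ⟪b s, e k⟫ * ⟪w₂, e k⟫)) =
        ⟪y t, e k⟫ * ⟪w, e k⟫ - ⟪y 0, e k⟫ * ⟪w, e k⟫ := fun k => by
      refine intervalIntegral.integral_eq_sub_of_hasDeriv_right_of_le
        (f := fun s => ⟪y s, e k⟫ * ⟪w, e k⟫) ht (by fun_prop) (fun s hs => ?_)
        (Continuous.intervalIntegrable (by fun_prop) _ _)
      rw [← hc]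
      exact ((hd k s hs.1.le).mono (fun x hx => hs.1.le.trans (le_of_lt hx) :
        Set.Ioi s ⊆ Set.Ici 0)).mul_const _
    simp only [hk] at hsum
    have := hsum.unique ((hpar (y t) w).sub (hpar (y 0) w))
    linarith
  have hD : HasDerivAt (fun t => ⟪y 0, w⟫ + ∫ s in (0 : ℝ)..t, (⟪a s, w₁⟫ + ⟪b s, w₂⟫))
      (⟪a t, w₁⟫ + ⟪b t, w₂⟫) t :=
    (hgc.integral_hasStrictDerivAt 0 t).hasDerivAt.const_add _
  exact hD.hasDerivWithinAt.congr hint (hint t ht)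

theorem IsSolution.norm_sub_sq_le (he : IsEigenbasis A lam e) (hlam : ∀ k, 0 ≤ lam k)
    {F : H → H} {L : ℝ≥0} (hF : LipschitzWith L F) {ξ η : ℝ → PhaseSpace H}
    (hξ : IsSolution A F ξ) (hη : IsSolution A F η) {t : ℝ} (ht : 0 ≤ t) :
    ‖ξ t - η t‖ ^ 2 ≤ Real.exp ((1 + (L : ℝ) ^ 2) * t) * ‖ξ 0 - η 0‖ ^ 2 := by
  have := ((hξ.isModalSolution he hF.continuous).sub
    (hη.isModalSolution he hF.continuous)).lipschitz_estimate hlam (L := L)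
    (fun t _ => hF.norm_sub_le _ _) ht
  rw [PhaseSpace.norm_sq, PhaseSpace.norm_sq]
  exact this

theorem IsSolutionSemigroup.add {F : H → H} {S : ℝ → PhaseSpace H → PhaseSpace H}
    (hS : IsSolutionSemigroup A F S) {s t : ℝ} (ξ : PhaseSpace H) (hs : 0 ≤ s)
    (ht : 0 ≤ t) : S (s + t) ξ = S s (S t ξ) := by
  have hmaps : Set.MapsTo (fun r : ℝ => r + t) (Set.Ici 0) (Set.Ici 0) := fun r hr =>
    add_nonneg hr ht
  have hsol := hS.isSolution ξ
  have hd : ∀ r : ℝ, HasDerivWithinAt (fun r : ℝ => r + t) 1 (Set.Ici 0) r := fun r =>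
    ((hasDerivAt_id r).add_const t).hasDerivWithinAt
  have h : IsSolution A F (fun r => S (r + t) ξ) :=
    { continuousOn := hsol.continuousOn.comp (by fun_prop) hmaps
      eq_fst := fun w r hr => by
        have := (hsol.eq_fst w (r + t) (add_nonneg hr ht)).comp r (hd r) hmaps
        rw [mul_one] at this
        exact this
      eq_snd := fun w r hr => by
        have := (hsol.eq_snd w (r + t) (add_nonneg hr ht)).comp r (hd r) hmaps
        rw [mul_one] at this
        exact this }
  have := hS.unique _ h s hs
  simpa using this

theorem IsSolutionSemigroup.norm_sub_le {F : H → H} {S : ℝ → PhaseSpace H → PhaseSpace H}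
    (hS : IsSolutionSemigroup A F S) (he : IsEigenbasis A lam e)
    (hlam : ∀ k, 0 ≤ lam k) {L : ℝ≥0} (hF : LipschitzWith L F) {t : ℝ} (ht : 0 ≤ t)
    (ξ η : PhaseSpace H) :
    ‖S t ξ - S t η‖ ≤ Real.exp ((1 + (L : ℝ) ^ 2) / 2 * t) * ‖ξ - η‖ := by
  have := (hS.isSolution ξ).norm_sub_sq_le he hlam hF (hS.isSolution η) ht
  simp only [hS.zero] at this
  refine le_of_sq_le_sq (this.trans_eq ?_) (by positivity)
  rw [mul_pow, ← Real.exp_nat_mul]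
  congr 2
  push_cast
  ring

variable [CompleteSpace H]

theorem IsEigenbasis.pos (he : IsEigenbasis A lam e) (hA : IsPosSelfAdjointCompactInv A) (k : ℕ) :
    0 < lam k := by
  obtain ⟨x, hx, hAx⟩ := he.eigen k
  have h1 : ‖e k‖ = 1 := e.orthonormal.1 k
  have hne : (x : H) ≠ 0 := by
    rw [hx]; intro h0; rw [h0, norm_zero] at h1; exact zero_ne_one h1
  have := hA.pos x hne
  rw [hAx, hx, inner_smul_left, real_inner_self_eq_norm_sq, h1] at this
  simpa using this

theorem IsPosSelfAdjointCompactInv.symm (hA : IsPosSelfAdjointCompactInv A) (x y : A.domain) :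
    ⟪A x, (y : H)⟫ = ⟪(x : H), A y⟫ := by
  have h := LinearPMap.adjoint_isFormalAdjoint hA.dense_domain
  have h2 : A.adjoint = A := hA.selfAdjoint
  rw [h2] at h
  exact h x y

theorem IsEigenbasis.inner_apply (he : IsEigenbasis A lam e) (hA : IsPosSelfAdjointCompactInv A)
    (w : A.domain) (k : ℕ) : ⟪A w, e k⟫ = lam k * ⟪(w : H), e k⟫ := by
  obtain ⟨x, hx, hAx⟩ := he.eigen k
  rw [← hx, hA.symm, hAx, hx, inner_smul_right]

theorem IsModalSolution.isSolution (he : IsEigenbasis A lam e)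
    (hA : IsPosSelfAdjointCompactInv A) {F : H → H} {u v : ℝ → H}
    (h : IsModalSolution e lam u v (fun t => F (u t))) (hu : Continuous u) (hv : Continuous v)
    (hF : Continuous F) : IsSolution A F (fun t => WithLp.toLp 2 (u t, v t)) where
  continuousOn := ((WithLp.prod_continuous_toLp 2 H H).comp (hu.prodMk hv)).continuousOn
  eq_fst w t ht := by
    have := hasDerivWithinAt_inner_of_modes e hu hu hv (w := (w : H)) (w₁ := -A w) (w₂ := -A w)
      h.deriv_fst (fun k t => by
        rw [inner_neg_left, he.inner_apply hA]; ring) ht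
    exact this.congr_deriv (by rw [inner_neg_right, inner_neg_right]; rfl)
  eq_snd w t ht := by
    have := hasDerivWithinAt_inner_of_modes e hv hv (hF.comp hu) (w := (w : H)) (w₁ := -A w)
      (w₂ := (w : H)) h.deriv_snd (fun k t => by
        rw [inner_neg_left, he.inner_apply hA, Function.comp_apply]; ring) ht
    exact this.congr_deriv (by rw [inner_neg_right]; rfl)

theorem exists_isSolutionSemigroup (he : IsEigenbasis A lam e)
    (hA : IsPosSelfAdjointCompactInv A) {F : H → H} {L : ℝ≥0} (hF : LipschitzWith L F) :
    ∃ S, IsSolutionSemigroup A F S := by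
  have hlam : ∀ k, 0 ≤ lam k := fun k => (he.pos hA k).le
  choose u v hu hv hu0 hv0 h using fun ξ₀ : PhaseSpace H =>
    exists_isModalSolution e hlam hF ξ₀.fst ξ₀.snd
  have hsol : ∀ ξ₀, IsSolution A F (fun t => WithLp.toLp 2 (u ξ₀ t, v ξ₀ t)) := fun ξ₀ =>
    (h ξ₀).isSolution he hA (hu ξ₀) (hv ξ₀) hF.continuous
  have h0 : ∀ ξ₀ : PhaseSpace H, WithLp.toLp 2 (u ξ₀ 0, v ξ₀ 0) = ξ₀ := fun ξ₀ => by
    rw [hu0, hv0]; rfl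
  refine ⟨fun t ξ₀ => WithLp.toLp 2 (u ξ₀ t, v ξ₀ t), h0, hsol, fun ξ hξ t ht => ?_⟩
  -- Uniqueness is the Lipschitz estimate for two solutions with equal initial data.
  have := hξ.norm_sub_sq_le he hlam hF (hsol (ξ 0)) ht
  rw [h0, sub_self, norm_zero, zero_pow two_ne_zero, mul_zero] at this
  exact sub_eq_zero.1 (norm_eq_zero.1 (pow_eq_zero_iff two_ne_zero |>.1
    (le_antisymm this (sq_nonneg _))))

end Semigroup

/-! ### The base, its projections and the quadratic form of the cone. -/

section Projections

variable {H : Type*} [NormedAddCommGroup H] [InnerProductSpace ℝ H] (e : HilbertBasis ℕ ℝ H) (n : ℕ)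

instance finiteDimensional_modes : FiniteDimensional ℝ (modes e n) :=
  FiniteDimensional.span_of_finite ℝ ((Set.finite_Iio n).image _)

theorem finrank_modes : Module.finrank ℝ (modes e n) = n := by
  have h1 : (fun k => e k) '' Set.Iio n = Set.range fun k : Fin n => e k := by
    ext x
    simp only [Set.mem_image, Set.mem_Iio, Set.mem_range]
    exact ⟨fun ⟨k, hk, hx⟩ => ⟨⟨k, hk⟩, hx⟩, fun ⟨k, hx⟩ => ⟨k, k.2, hx⟩⟩
  rw [modes, h1, finrank_span_eq_card, Fintype.card_fin]
  exact e.orthonormal.linearIndependent.comp _ Fin.val_injective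

/-- The base is the product of two copies of the span of the first modes. -/
def baseEquiv : base e n ≃ₗ[ℝ] modes e n × modes e n where
  toFun p := (⟨(p : PhaseSpace H).fst, p.2.1⟩, ⟨(p : PhaseSpace H).snd, p.2.2⟩)
  map_add' _ _ := rfl
  map_smul' _ _ := rfl
  invFun q := ⟨WithLp.toLp 2 ((q.1 : H), (q.2 : H)), ⟨q.1.2, q.2.2⟩⟩
  left_inv _ := rfl
  right_inv _ := rfl

instance finiteDimensional_base : FiniteDimensional ℝ (base e n) :=
  LinearEquiv.finiteDimensional (baseEquiv e n).symm

theorem finrank_base : Module.finrank ℝ (base e n) = 2 * n := by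
  rw [(baseEquiv e n).finrank_eq, Module.finrank_prod, finrank_modes, two_mul]

theorem mem_modes {k : ℕ} (hk : k < n) : e k ∈ modes e n :=
  Submodule.subset_span ⟨k, hk, rfl⟩

theorem inner_eq_zero_of_mem_modes {x : H} (hx : x ∈ modes e n) {k : ℕ} (hk : n ≤ k) :
    ⟪x, e k⟫ = 0 := by
  induction hx using Submodule.span_induction with
  | mem x hx =>
    obtain ⟨j, hj, rfl⟩ := hx
    exact e.orthonormal.2 (ne_of_lt (lt_of_lt_of_le hj hk))
  | zero => exact inner_zero_left _
  | add x y _ _ hx hy => rw [inner_add_left, hx, hy, add_zero]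
  | smul c x _ hx => rw [inner_smul_left, hx, mul_zero]

theorem inner_starProjection_modes (x : H) (k : ℕ) :
    ⟪(modes e n).starProjection x, e k⟫ = if k < n then ⟪x, e k⟫ else 0 := by
  split_ifs with hk
  · have := Submodule.starProjection_inner_eq_zero (K := modes e n) x (e k) (mem_modes e n hk)
    rw [inner_sub_left] at this
    linarith
  · exact inner_eq_zero_of_mem_modes e n (Submodule.starProjection_apply_mem _ _) (not_lt.1 hk)

theorem starProjection_base (ξ : PhaseSpace H) :
    (base e n).starProjection ξ = WithLp.toLp 2
      ((modes e n).starProjection ξ.fst, (modes e n).starProjection ξ.snd) := by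
  refine Submodule.eq_starProjection_of_mem_of_inner_eq_zero ?_ fun η hη => ?_
  · exact ⟨Submodule.starProjection_apply_mem _ _, Submodule.starProjection_apply_mem _ _⟩
  · rw [WithLp.prod_inner_apply]
    have h1 := Submodule.starProjection_inner_eq_zero (K := modes e n) ξ.fst η.fst hη.1
    have h2 := Submodule.starProjection_inner_eq_zero (K := modes e n) ξ.snd η.snd hη.2
    exact (congrArg₂ (· + ·) h1 h2).trans (add_zero 0)

theorem norm_sq_starProjection_base (ξ : PhaseSpace H) :
    ‖(base e n).starProjection ξ‖ ^ 2 =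
      ‖(modes e n).starProjection ξ.fst‖ ^ 2 + ‖(modes e n).starProjection ξ.snd‖ ^ 2 := by
  rw [starProjection_base, PhaseSpace.norm_sq]
  rfl

theorem norm_sq_sub_starProjection_base (ξ : PhaseSpace H) :
    ‖ξ - (base e n).starProjection ξ‖ ^ 2 =
      ‖ξ.fst - (modes e n).starProjection ξ.fst‖ ^ 2 +
        ‖ξ.snd - (modes e n).starProjection ξ.snd‖ ^ 2 := by
  rw [starProjection_base, PhaseSpace.norm_sq]
  rfl

theorem norm_sq_starProjection_modes (x : H) :
    ‖(modes e n).starProjection x‖ ^ 2 = ∑ k ∈ Finset.range n, ⟪x, e k⟫ ^ 2 := by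
  refine (hasSum_sq_inner e _).unique ?_
  simp only [inner_starProjection_modes]
  have : ∑ k ∈ Finset.range n, ⟪x, e k⟫ ^ 2 =
      ∑ k ∈ Finset.range n, (if k < n then ⟪x, e k⟫ else 0) ^ 2 :=
    Finset.sum_congr rfl fun k hk => by rw [if_pos (Finset.mem_range.1 hk)]
  rw [this]
  refine hasSum_sum_of_ne_finset_zero fun k hk => ?_
  rw [if_neg (fun h => hk (Finset.mem_range.2 h)), zero_pow two_ne_zero]

/-- The quadratic form with weight `α₁` (resp. `β₁`) on the tail of the first (resp. second)
component and `-α₀` (resp. `-β₀`) on its first `n` modes. -/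
noncomputable def coneForm (α₀ α₁ β₀ β₁ : ℝ) (x y : H) : ℝ :=
  (α₁ * ‖x - (modes e n).starProjection x‖ ^ 2 - α₀ * ‖(modes e n).starProjection x‖ ^ 2) +
    (β₁ * ‖y - (modes e n).starProjection y‖ ^ 2 - β₀ * ‖(modes e n).starProjection y‖ ^ 2)

theorem hasSum_headTail (α₀ α₁ : ℝ) (x : H) :
    HasSum (fun k => (if k < n then -α₀ else α₁) * ⟪x, e k⟫ ^ 2)
      (α₁ * ‖x - (modes e n).starProjection x‖ ^ 2 -
        α₀ * ‖(modes e n).starProjection x‖ ^ 2) := by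
  refine (((hasSum_sq_inner e (x - (modes e n).starProjection x)).mul_left α₁).sub
    ((hasSum_sq_inner e ((modes e n).starProjection x)).mul_left α₀)).congr_fun fun k => ?_
  rw [inner_sub_left, inner_starProjection_modes]
  split_ifs <;> ring

theorem hasSum_coneForm (α₀ α₁ β₀ β₁ : ℝ) (x y : H) :
    HasSum (fun k => (if k < n then -α₀ else α₁) * ⟪x, e k⟫ ^ 2 +
      (if k < n then -β₀ else β₁) * ⟪y, e k⟫ ^ 2) (coneForm e n α₀ α₁ β₀ β₁ x y) :=
  (hasSum_headTail e n α₀ α₁ x).add (hasSum_headTail e n β₀ β₁ y)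

theorem continuous_coneForm (α₀ α₁ β₀ β₁ : ℝ) :
    Continuous fun ξ : PhaseSpace H => coneForm e n α₀ α₁ β₀ β₁ ξ.fst ξ.snd := by
  have h1 := WithLp.continuous_fst 2 H H
  have h2 := WithLp.continuous_snd 2 H H
  unfold coneForm
  fun_prop

/-- Applied to the low-mode projection and to its complement, this yields `V_sub` for the cone form.
-/
theorem abs_sq_norm_map_sub_le (T : H →L[ℝ] H) (hT : ∀ x, ‖T x‖ ≤ ‖x‖) (x y : H) :
    |‖T (x - y)‖ ^ 2 - ‖T y‖ ^ 2| ≤ ‖x‖ * (‖x‖ + 2 * ‖y‖) := by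
  have h1 : ‖T (x - y)‖ ^ 2 = ‖T x‖ ^ 2 - 2 * ⟪T x, T y⟫ + ‖T y‖ ^ 2 := by
    rw [map_sub, norm_sub_sq_real]
  have h2 := abs_le.1 (abs_real_inner_le_norm (T x) (T y))
  have h3 : ‖T x‖ * ‖T y‖ ≤ ‖x‖ * ‖y‖ := mul_le_mul (hT x) (hT y) (norm_nonneg _) (norm_nonneg _)
  have h4 : ‖T x‖ ^ 2 ≤ ‖x‖ ^ 2 := pow_le_pow_left₀ (norm_nonneg _) (hT x) 2
  rw [h1, abs_le]
  constructor <;> nlinarith [sq_nonneg ‖T x‖, sq_nonneg ‖x‖]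

theorem coneForm_sub_le {α₀ α₁ β₀ β₁ : ℝ} (hα₀ : 0 ≤ α₀) (hα₁ : 0 ≤ α₁) (hβ₀ : 0 ≤ β₀)
    (hβ₁ : 0 ≤ β₁) (ξ η : PhaseSpace H) :
    coneForm e n α₀ α₁ β₀ β₁ (ξ - η).fst (ξ - η).snd ≤
      coneForm e n α₀ α₁ β₀ β₁ η.fst η.snd +
        (α₀ + α₁ + β₀ + β₁) * ‖ξ‖ * (‖ξ‖ + 2 * ‖η‖) := by
  set P := (modes e n).starProjection with hP
  have hQ : ∀ x, ‖((1 : H →L[ℝ] H) - P) x‖ ≤ ‖x‖ := fun x => by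
    rw [hP, ← Submodule.starProjection_orthogonal']
    exact Submodule.norm_starProjection_apply_le _ _
  have hPn : ∀ x, ‖P x‖ ≤ ‖x‖ := fun x => Submodule.norm_starProjection_apply_le _ _
  set R := ‖ξ‖ * (‖ξ‖ + 2 * ‖η‖) with hR
  have b1 : ‖ξ.fst‖ * (‖ξ.fst‖ + 2 * ‖η.fst‖) ≤ R := by
    have h1 := PhaseSpace.norm_fst_le ξ
    have h2 := PhaseSpace.norm_fst_le η
    rw [hR]; gcongr
  have b2 : ‖ξ.snd‖ * (‖ξ.snd‖ + 2 * ‖η.snd‖) ≤ R := by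
    have h1 := PhaseSpace.norm_snd_le ξ
    have h2 := PhaseSpace.norm_snd_le η
    rw [hR]; gcongr
  have e1 := abs_le.1 ((abs_sq_norm_map_sub_le _ hQ ξ.fst η.fst).trans b1)
  have e2 := abs_le.1 ((abs_sq_norm_map_sub_le _ hPn ξ.fst η.fst).trans b1)
  have e3 := abs_le.1 ((abs_sq_norm_map_sub_le _ hQ ξ.snd η.snd).trans b2)
  have e4 := abs_le.1 ((abs_sq_norm_map_sub_le _ hPn ξ.snd η.snd).trans b2)
  have k1 := mul_le_mul_of_nonneg_left e1.2 hα₁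
  have k2 := mul_le_mul_of_nonneg_left e2.1 hα₀
  have k3 := mul_le_mul_of_nonneg_left e3.2 hβ₁
  have k4 := mul_le_mul_of_nonneg_left e4.1 hβ₀
  simp only [coneForm, WithLp.sub_fst, WithLp.sub_snd, ← hP]
  simp only [sub_apply, one_apply_eq_self] at k1 k3
  rw [mul_assoc, ← hR]
  linarith

theorem le_coneForm {α₀ α₁ β₀ β₁ a b : ℝ} (hα₀ : α₀ ≤ b) (hα₁ : a ≤ α₁) (hβ₀ : β₀ ≤ b)
    (hβ₁ : a ≤ β₁) (ξ : PhaseSpace H) :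
    a * ‖ξ - (base e n).starProjection ξ‖ ^ 2 - b * ‖(base e n).starProjection ξ‖ ^ 2 ≤
      coneForm e n α₀ α₁ β₀ β₁ ξ.fst ξ.snd := by
  rw [norm_sq_starProjection_base, norm_sq_sub_starProjection_base, coneForm]
  have h1 := mul_le_mul_of_nonneg_right hα₀ (sq_nonneg ‖(modes e n).starProjection ξ.fst‖)
  have h2 := mul_le_mul_of_nonneg_right hβ₀ (sq_nonneg ‖(modes e n).starProjection ξ.snd‖)
  have h3 := mul_le_mul_of_nonneg_right hα₁
    (sq_nonneg ‖ξ.fst - (modes e n).starProjection ξ.fst‖)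
  have h4 := mul_le_mul_of_nonneg_right hβ₁
    (sq_nonneg ‖ξ.snd - (modes e n).starProjection ξ.snd‖)
  linarith

theorem coneForm_le {α₀ α₁ β₀ β₁ a b : ℝ} (hα₀ : a ≤ α₀) (hα₁ : α₁ ≤ b) (hβ₀ : a ≤ β₀)
    (hβ₁ : β₁ ≤ b) (ξ : PhaseSpace H) :
    coneForm e n α₀ α₁ β₀ β₁ ξ.fst ξ.snd ≤
      b * ‖ξ - (base e n).starProjection ξ‖ ^ 2 - a * ‖(base e n).starProjection ξ‖ ^ 2 := by
  rw [norm_sq_starProjection_base, norm_sq_sub_starProjection_base, coneForm]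
  have h1 := mul_le_mul_of_nonneg_right hα₀ (sq_nonneg ‖(modes e n).starProjection ξ.fst‖)
  have h2 := mul_le_mul_of_nonneg_right hβ₀ (sq_nonneg ‖(modes e n).starProjection ξ.snd‖)
  have h3 := mul_le_mul_of_nonneg_right hα₁
    (sq_nonneg ‖ξ.fst - (modes e n).starProjection ξ.fst‖)
  have h4 := mul_le_mul_of_nonneg_right hβ₁
    (sq_nonneg ‖ξ.snd - (modes e n).starProjection ξ.snd‖)
  linarith

end Projections

/-! ### The cone condition, mode by mode. -/

section ModalInequality

/-- The quadratic inequality behind the cone condition, in a single mode. -/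
theorem modal_inequality {m κ q μ l : ℝ} (hm : 0 < m) (hκ : 0 ≤ κ) (hq1 : q ≤ 1)
    (hμ : m ≤ μ) (hl : 0 ≤ l) (hlμ : κ * l ≤ q * m * μ) (x y z : ℝ) :
    -2 * μ * (κ ^ 2 / m * x ^ 2 + m * y ^ 2) + 2 * (κ ^ 2 / m) * l * x * y + 2 * m * y * z ≤
      z ^ 2 - (2 - q) * κ ^ 2 * x ^ 2 - (1 - q) * m ^ 2 * y ^ 2 := by
  set A := κ ^ 2 / m with hA
  have hA0 : 0 ≤ A := by positivity
  have hAm : A * m = κ ^ 2 := div_mul_cancel₀ _ hm.ne'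
  have hμ0 : 0 < μ := hm.trans_le hμ
  have hq0 : 0 ≤ q := by
    by_contra! h
    have := mul_neg_of_neg_of_pos (mul_neg_of_neg_of_pos h hm) hμ0
    linarith [mul_nonneg hκ hl]
  -- The weights satisfy `A * m = κ ^ 2`. This turns `hlμ` into control of the cross term by the
  -- fraction `q * μ` of the dissipation.
  have h1 : A * l ≤ κ * q * μ := by
    refine le_of_mul_le_mul_right ?_ hm
    have := mul_le_mul_of_nonneg_left hlμ hκ
    calc A * l * m = κ * (κ * l) := by rw [mul_right_comm, hAm]; ring
      _ ≤ κ * q * μ * m := by linarith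
  have h2 : 2 * κ * (|x| * |y|) ≤ A * x ^ 2 + m * y ^ 2 := by
    have h3 : 0 ≤ (A * |x| - κ * |y|) ^ 2 + (κ * |x| - m * |y|) ^ 2 := by positivity
    have hx := sq_abs x
    have hy := sq_abs y
    refine le_of_mul_le_mul_right ?_ hm
    have h4 : 0 ≤ (κ * |x| - m * |y|) ^ 2 := sq_nonneg _
    have h5 : (κ * |x| - m * |y|) ^ 2 =
        (A * m) * x ^ 2 - 2 * κ * m * (|x| * |y|) + m ^ 2 * y ^ 2 := by
      rw [hAm, ← hx, ← hy]; ring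
    linarith
  have h3 : 2 * A * l * x * y ≤ q * μ * (A * x ^ 2 + m * y ^ 2) := by
    have h4 : x * y ≤ |x| * |y| := by rw [← abs_mul]; exact le_abs_self _
    calc 2 * A * l * x * y = 2 * (A * l) * (x * y) := by ring
      _ ≤ 2 * (A * l) * (|x| * |y|) := by gcongr
      _ ≤ 2 * (κ * q * μ) * (|x| * |y|) := by gcongr
      _ = q * μ * (2 * κ * (|x| * |y|)) := by ring
      _ ≤ _ := mul_le_mul_of_nonneg_left h2 (by positivity)
  have h4 : κ ^ 2 * x ^ 2 + m ^ 2 * y ^ 2 ≤ μ * (A * x ^ 2 + m * y ^ 2) := by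
    calc κ ^ 2 * x ^ 2 + m ^ 2 * y ^ 2 = m * (A * x ^ 2 + m * y ^ 2) := by rw [← hAm]; ring
      _ ≤ _ := mul_le_mul_of_nonneg_right hμ (by positivity)
  -- The dissipation left after the cross term has coefficient `(2 - q) * μ`. One unit of `m² y²`
  -- then pays for the force term, which leaves `1 - q`.
  have h5 := mul_le_mul_of_nonneg_left h4 (by linarith : 0 ≤ 2 - q)
  have h6 : 2 * m * y * z ≤ z ^ 2 + m ^ 2 * y ^ 2 := by nlinarith [sq_nonneg (z - m * y)]
  linarith

variable {H : Type*} [NormedAddCommGroup H] [InnerProductSpace ℝ H]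
  {e : HilbertBasis ℕ ℝ H} {lam : ℕ → ℝ} {n : ℕ}

/-- The strong cone condition: `α²` and `β²` are the two consecutive eigenvalues with spectral
gap `β - α` of the square roots. -/
theorem IsModalSolution.cone_estimate {u v f : ℝ → H} (h : IsModalSolution e lam u v f)
    {α β κ ε : ℝ} (hα : 0 < α) (hαβ : α < β) (hlam : ∀ k, 0 ≤ lam k)
    (hlow : ∀ k < n, lam k ≤ α ^ 2) (hhigh : ∀ k, n ≤ k → β ^ 2 ≤ lam k)
    (hκ : 0 ≤ κ) (hκg : κ ≤ (β - α) ^ 2)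
    (hε : ε ≤ (1 - κ / (β - α) ^ 2) * κ ^ 2)
    (hεα : ε ≤ (1 - κ / (β - α) ^ 2) * (α * (β - α)) ^ 2)
    (hεβ : ε ≤ (1 - κ / (β - α) ^ 2) * (β * (β - α)) ^ 2) {t : ℝ} (ht : 0 ≤ t) :
    Real.exp (2 * (α * β) * t) * coneForm e n (κ ^ 2 / (α * (β - α))) (κ ^ 2 / (β * (β - α)))
        (α * (β - α)) (β * (β - α)) (u t) (v t) ≤
      coneForm e n (κ ^ 2 / (α * (β - α))) (κ ^ 2 / (β * (β - α)))
        (α * (β - α)) (β * (β - α)) (u 0) (v 0) +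
      ∫ s in (0 : ℝ)..t, Real.exp (2 * (α * β) * s) *
        (‖f s‖ ^ 2 - (κ ^ 2 + ε) * ‖u s‖ ^ 2 - ε * ‖v s‖ ^ 2) := by
  have hg : 0 < β - α := sub_pos.2 hαβ
  have hβ : 0 < β := hα.trans hαβ
  set q := κ / (β - α) ^ 2 with hq
  have hqg : q * (β - α) ^ 2 = κ := div_mul_cancel₀ _ (by positivity)
  have hq1 : q ≤ 1 := (div_le_one (by positivity)).2 hκg
  have hq0 : 0 ≤ q := by positivity
  refine h.energy (hasSum_coneForm e n _ _ _ _) (fun k x y z => ?_) ht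
  have hx := mul_le_mul_of_nonneg_right hε (sq_nonneg x)
  by_cases hk : k < n
  · simp only [if_pos hk]
    have hy := mul_le_mul_of_nonneg_right hεα (sq_nonneg y)
    have hlk := hlow k hk
    -- Here `m = αβ - α²` is the least possible `μ`. The bound `l g ≤ α (αβ - l)` is an equality at
    -- `l = α²`. Replacing `z` by `-z` accounts for the negative weights.
    have key := modal_inequality (m := α * (β - α)) (κ := κ) (q := q) (μ := α * β - lam k)
      (l := lam k) (by positivity) hκ hq1 (by linarith) (hlam k) (by
        rw [← hqg]
        have : lam k * (α * (β - α)) ≤ α ^ 2 * (α * β - lam k) := by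
          nlinarith [mul_nonneg (sub_nonneg.2 hlk) (mul_pos hα hβ).le]
        have h2 : lam k * (β - α) ≤ α * (α * β - lam k) := by
          refine le_of_mul_le_mul_left ?_ hα
          linarith
        have h3 := mul_le_mul_of_nonneg_left h2 (by positivity : 0 ≤ q * (β - α))
        linarith) x y (-z)
    linarith
  · simp only [if_neg hk]
    have hy := mul_le_mul_of_nonneg_right hεβ (sq_nonneg y)
    have hlk := hhigh k (not_lt.1 hk)
    -- Now `m = β² - αβ`, and `l g ≤ β (l - αβ)` is an equality at `l = β²`. The change of sign of
    -- `x` matches the cross term.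
    have key := modal_inequality (m := β * (β - α)) (κ := κ) (q := q) (μ := lam k - α * β)
      (l := lam k) (by positivity) hκ hq1 (by linarith) (hlam k) (by
        rw [← hqg]
        have : lam k * (β * (β - α)) ≤ β ^ 2 * (lam k - α * β) := by
          nlinarith [mul_nonneg (sub_nonneg.2 hlk) (mul_pos hα hβ).le]
        have h2 : lam k * (β - α) ≤ β * (lam k - α * β) := by
          refine le_of_mul_le_mul_left ?_ hβ
          linarith
        have h3 := mul_le_mul_of_nonneg_left h2 (by positivity : 0 ≤ q * (β - α))
        linarith) (-x) y z
    linarith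

/-- Over a unit of time, the low modes of a solution move at a bounded speed. -/
theorem IsModalSolution.norm_starProjection_sub_le {u v f : ℝ → H}
    (h : IsModalSolution e lam u v f) {l R L : ℝ} (hlam : ∀ k, 0 ≤ lam k)
    (hlow : ∀ k < n, lam k ≤ l) (hl : 0 ≤ l) (hL : 0 ≤ L) {t : ℝ} (ht : 0 ≤ t)
    (hu : ∀ s ∈ Set.Icc 0 t, ‖u s‖ ≤ R) (hv : ∀ s ∈ Set.Icc 0 t, ‖v s‖ ≤ R)
    (hf : ∀ s ∈ Set.Icc 0 t, ‖f s‖ ≤ L * R) :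
    ‖(modes e n).starProjection (u t - u 0)‖ ^ 2 + ‖(modes e n).starProjection (v t - v 0)‖ ^ 2 ≤
      2 * n * ((2 * l + L) * R * t) ^ 2 := by
  have hR : 0 ≤ R := (norm_nonneg _).trans (hu 0 ⟨le_rfl, ht⟩)
  have hin : ∀ (x : H) k, |⟪x, e k⟫| ≤ ‖x‖ := fun x k => by
    have := abs_real_inner_le_norm x (e k)
    rwa [e.orthonormal.1 k, mul_one] at this
  have key : ∀ (y : ℝ → H) (c : ℕ → ℝ → ℝ), (∀ k t, 0 ≤ t →
      HasDerivWithinAt (fun s => ⟪y s, e k⟫) (c k t) (Set.Ici 0) t) →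
      (∀ k < n, ∀ s ∈ Set.Icc 0 t, |c k s| ≤ (2 * l + L) * R) →
      ‖(modes e n).starProjection (y t - y 0)‖ ^ 2 ≤ n * ((2 * l + L) * R * t) ^ 2 := by
    intro y c hd hc
    rw [norm_sq_starProjection_modes]
    refine (Finset.sum_le_card_nsmul _ _ (((2 * l + L) * R * t) ^ 2) fun k hk => ?_).trans_eq
      (by simp)
    have := norm_image_sub_le_of_norm_deriv_le_segment' (f := fun s => ⟪y s, e k⟫)
      (f' := c k) (a := 0) (b := t) (C := (2 * l + L) * R)
      (fun s hs => (hd k s hs.1).mono fun r hr => hr.1)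
      (fun s hs => hc k (Finset.mem_range.1 hk) s ⟨hs.1, hs.2.le⟩) t ⟨ht, le_rfl⟩
    rw [sub_zero, Real.norm_eq_abs] at this
    rw [inner_sub_left, ← sq_abs]
    exact pow_le_pow_left₀ (abs_nonneg _) this 2
  have h1 := key u _ h.deriv_fst fun k hk s hs => by
    rw [abs_mul, abs_neg, abs_of_nonneg (hlam k)]
    have h2 := (abs_add_le ⟪u s, e k⟫ ⟪v s, e k⟫).trans
      (add_le_add ((hin _ k).trans (hu s hs)) ((hin _ k).trans (hv s hs)))
    calc lam k * |⟪u s, e k⟫ + ⟪v s, e k⟫| ≤ l * (R + R) :=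
          mul_le_mul (hlow k hk) h2 (abs_nonneg _) hl
      _ ≤ _ := by nlinarith [mul_nonneg hL hR]
  have h2 := key v _ h.deriv_snd fun k hk s hs => by
    refine (abs_add_le _ _).trans ?_
    rw [abs_mul, abs_neg, abs_of_nonneg (hlam k)]
    have h3 := (hin (f s) k).trans (hf s hs)
    have h4 : lam k * |⟪v s, e k⟫| ≤ l * R :=
      mul_le_mul (hlow k hk) ((hin _ k).trans (hv s hs)) (abs_nonneg _) hl
    nlinarith [mul_nonneg hl hR]
  linarith

end ModalInequality

/-! ### The spectral gap yields a cone system. -/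

section SpectralGap

variable {H : Type*} [NormedAddCommGroup H] [InnerProductSpace ℝ H]
  {A : H →ₗ.[ℝ] H} {lam : ℕ → ℝ} {e : HilbertBasis ℕ ℝ H} {n : ℕ} {F : H → H}
  {S : ℝ → PhaseSpace H → PhaseSpace H}

/-- Serves `cone` with `C = 0`, for differences, and `growth` with the constant produced by `F 0`.
-/
theorem IsModalSolution.integral_force_le {u v f : ℝ → H} (h : IsModalSolution e lam u v f)
    {θ κ ε C : ℝ} (hθ : 0 < θ) (hC : 0 ≤ C)
    (hf : ∀ s, 0 ≤ s → ‖f s‖ ^ 2 ≤ κ ^ 2 * ‖u s‖ ^ 2 + C) {t : ℝ} (ht : 0 ≤ t) :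
    (∫ s in (0 : ℝ)..t, Real.exp (2 * θ * s) *
        (‖f s‖ ^ 2 - (κ ^ 2 + ε) * ‖u s‖ ^ 2 - ε * ‖v s‖ ^ 2)) ≤
      C / (2 * θ) * Real.exp (2 * θ * t) -
        ε * ∫ s in (0 : ℝ)..t, Real.exp (2 * θ * s) * (‖u s‖ ^ 2 + ‖v s‖ ^ 2) := by
  have hsub : Set.uIcc 0 t ⊆ Set.Ici 0 := by
    rw [Set.uIcc_of_le ht]; exact fun s hs => hs.1
  have hu := h.cont_fst.mono hsub
  have hv := h.cont_snd.mono hsub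
  have hfc := h.cont_force.mono hsub
  have hexp : (∫ s in (0 : ℝ)..t, C * Real.exp (2 * θ * s)) =
      C / (2 * θ) * Real.exp (2 * θ * t) - C / (2 * θ) * Real.exp (2 * θ * 0) := by
    refine intervalIntegral.integral_eq_sub_of_hasDerivAt
      (f := fun s => C / (2 * θ) * Real.exp (2 * θ * s)) (fun s _ => ?_)
      (Continuous.intervalIntegrable (by fun_prop) _ _)
    refine (((hasDerivAt_id s).const_mul (2 * θ)).exp.const_mul (C / (2 * θ))).congr_deriv ?_
    simp only [id, mul_one]
    field_simp
  have i1 : IntervalIntegrable (fun s => C * Real.exp (2 * θ * s)) volume 0 t :=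
    Continuous.intervalIntegrable (by fun_prop) _ _
  have i2 : IntervalIntegrable (fun s => ε * (Real.exp (2 * θ * s) * (‖u s‖ ^ 2 + ‖v s‖ ^ 2)))
      volume 0 t := ContinuousOn.intervalIntegrable (by fun_prop)
  have i3 : IntervalIntegrable (fun s => Real.exp (2 * θ * s) *
      (‖f s‖ ^ 2 - (κ ^ 2 + ε) * ‖u s‖ ^ 2 - ε * ‖v s‖ ^ 2)) volume 0 t :=
    ContinuousOn.intervalIntegrable (by fun_prop)
  have hle := intervalIntegral.integral_mono_on ht i3 (i1.sub i2) fun s hs => by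
    have := mul_le_mul_of_nonneg_left (hf s hs.1) (Real.exp_pos (2 * θ * s)).le
    linarith
  rw [intervalIntegral.integral_sub i1 i2, hexp, intervalIntegral.integral_const_mul] at hle
  have : 0 ≤ C / (2 * θ) * Real.exp (2 * θ * 0) := by positivity
  linarith

/-- Young's inequality: the room between `L` and `κ` absorbs the cross term of `‖x‖` and `‖F 0‖`. -/
theorem sq_norm_le_of_lipschitz {H : Type*} [NormedAddCommGroup H] {F : H → H} {L : ℝ≥0} (hF : LipschitzWith L F) {κ : ℝ} (hκ : (L : ℝ) < κ)
    (x : H) : ‖F x‖ ^ 2 ≤ κ ^ 2 * ‖x‖ ^ 2 + κ / (κ - L) * ‖F 0‖ ^ 2 := by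
  have hL : (0 : ℝ) ≤ L := L.2
  have hd : 0 < κ - L := sub_pos.2 hκ
  have h1 : ‖F x‖ ≤ L * ‖x‖ + ‖F 0‖ := by
    have h1 := hF.norm_sub_le x 0
    have h2 := norm_add_le (F x - F 0) (F 0)
    rw [sub_add_cancel] at h2
    rw [sub_zero] at h1
    linarith
  have h2 := pow_le_pow_left₀ (norm_nonneg _) h1 2
  refine h2.trans ?_
  have h3 : κ ^ 2 * ‖x‖ ^ 2 + κ / (κ - L) * ‖F 0‖ ^ 2 - (L * ‖x‖ + ‖F 0‖) ^ 2 =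
      (κ - L) * κ * ‖x‖ ^ 2 + L / (κ - L) * ((κ - L) * ‖x‖ - ‖F 0‖) ^ 2 := by
    field_simp
    ring
  have h4 : 0 ≤ (κ - L) * κ * ‖x‖ ^ 2 + L / (κ - L) * ((κ - L) * ‖x‖ - ‖F 0‖) ^ 2 := by
    have := hL.trans hκ.le
    positivity
  linarith

/-- Under the spectral gap condition the solution semigroup satisfies the strong cone condition. -/
theorem IsSolutionSemigroup.exists_coneSystem (hS : IsSolutionSemigroup A F S)
    (he : IsEigenbasis A lam e) {L : ℝ≥0} (hF : LipschitzWith L F) (hlam : ∀ k, 0 ≤ lam k)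
    {α β : ℝ} (hα : 0 < α) (hαβ : α < β) (hgap : (L : ℝ) < (β - α) ^ 2)
    (hlow : ∀ k < n, lam k ≤ α ^ 2) (hhigh : ∀ k, n ≤ k → β ^ 2 ≤ lam k) :
    ∃ (V : PhaseSpace H → ℝ) (Λ ε a b c C D : ℝ),
      ConeSystem (base e n) S V (α * β) Λ ε a b c C D := by
  have hL : (0 : ℝ) ≤ L := L.2
  have hβ : 0 < β := hα.trans hαβ
  have hg : 0 < β - α := sub_pos.2 hαβ
  -- The midpoint: the room above `L` absorbs `F 0`, and the room below the squared gap makes `ε`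
  -- positive.
  set κ := ((L : ℝ) + (β - α) ^ 2) / 2 with hκdef
  have hκ0 : 0 < κ := by positivity
  have hLκ : (L : ℝ) < κ := by linarith
  have hκg : κ < (β - α) ^ 2 := by linarith
  have hq : 0 < 1 - κ / (β - α) ^ 2 := sub_pos.2 ((div_lt_one (by positivity)).2 hκg)
  set α₀ := κ ^ 2 / (α * (β - α)) with hα₀
  set α₁ := κ ^ 2 / (β * (β - α)) with hα₁
  set β₀ := α * (β - α) with hβ₀
  set β₁ := β * (β - α) with hβ₁
  have p1 : 0 < α₀ := by positivity
  have p2 : 0 < α₁ := by positivity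
  have p3 : 0 < β₀ := by positivity
  have p4 : 0 < β₁ := by positivity
  obtain ⟨ε, hε, e1, e2, e3⟩ : ∃ ε, 0 < ε ∧ ε ≤ (1 - κ / (β - α) ^ 2) * κ ^ 2 ∧
      ε ≤ (1 - κ / (β - α) ^ 2) * β₀ ^ 2 ∧ ε ≤ (1 - κ / (β - α) ^ 2) * β₁ ^ 2 :=
    ⟨min ((1 - κ / (β - α) ^ 2) * κ ^ 2) (min ((1 - κ / (β - α) ^ 2) * β₀ ^ 2)
      ((1 - κ / (β - α) ^ 2) * β₁ ^ 2)), lt_min (by positivity) (lt_min (by positivity)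
      (by positivity)), min_le_left _ _, (min_le_right _ _).trans (min_le_left _ _),
      (min_le_right _ _).trans (min_le_right _ _)⟩
  obtain ⟨a, ha, a1, a2, a3, a4⟩ : ∃ a, 0 < a ∧ a ≤ α₀ ∧ a ≤ α₁ ∧ a ≤ β₀ ∧ a ≤ β₁ :=
    ⟨min (min α₀ α₁) (min β₀ β₁), lt_min (lt_min p1 p2) (lt_min p3 p4),
      (min_le_left _ _).trans (min_le_left _ _), (min_le_left _ _).trans (min_le_right _ _),
      (min_le_right _ _).trans (min_le_left _ _), (min_le_right _ _).trans (min_le_right _ _)⟩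
  set b := α₀ + α₁ + β₀ + β₁ with hb
  have hmod : ∀ ξ, IsModalSolution e lam (fun t => (S t ξ).fst) (fun t => (S t ξ).snd)
      (fun t => F (S t ξ).fst) := fun ξ => (hS.isSolution ξ).isModalSolution he hF.continuous
  have hC : 0 ≤ κ / (κ - L) * ‖F 0‖ ^ 2 := by
    have := sub_pos.2 hLκ
    positivity
  have hθ : 0 < α * β := by positivity
  set Λ := (1 + (L : ℝ) ^ 2) / 2 with hΛ
  have hΛ0 : 0 ≤ Λ := by positivity
  refine ⟨fun ξ => coneForm e n α₀ α₁ β₀ β₁ ξ.fst ξ.snd, Λ, ε, a, b, b,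
    κ / (κ - L) * ‖F 0‖ ^ 2 / (2 * (α * β)), √(2 * n) * ((2 * α ^ 2 + L) * Real.exp Λ),
    { theta_pos := hθ
      eps_pos := hε
      a_pos := ha
      b_pos := by positivity
      lambda_nonneg := hΛ0
      c_nonneg := by positivity
      C_nonneg := by positivity
      D_nonneg := by positivity
      V_lower := le_coneForm e n (by linarith) a2 (by linarith) a4
      V_upper := coneForm_le e n a1 (by linarith) a3 (by linarith)
      V_sub := coneForm_sub_le e n p1.le p2.le p3.le p4.le
      V_cont := continuous_coneForm e n _ _ _ _
      zero := hS.zero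
      add := fun s t x hs ht => hS.add x hs ht
      cont := fun x => (hS.isSolution x).continuousOn
      lip := fun t x y ht => hS.norm_sub_le he hlam hF ht x y
      cone := ?_
      growth := ?_
      near := ?_ }⟩
  · intro t x y ht
    have hsol := (hmod x).sub (hmod y)
    have h1 := hsol.cone_estimate hα hαβ hlam hlow hhigh hκ0.le hκg.le e1 e2 e3 ht
    have h2 := hsol.integral_force_le hθ le_rfl (κ := κ) (ε := ε) (fun s _ => by
      have h3 := (hF.norm_sub_le (S s x).fst (S s y).fst).trans
        (mul_le_mul_of_nonneg_right hLκ.le (norm_nonneg _))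
      have h4 := pow_le_pow_left₀ (norm_nonneg _) h3 2
      rw [mul_pow] at h4
      rwa [add_zero]) ht
    simp only [hS.zero] at h1
    have h3 : (∫ r in (0 : ℝ)..t, Real.exp (2 * (α * β) * r) * ‖S r x - S r y‖ ^ 2) =
        ∫ s in (0 : ℝ)..t, Real.exp (2 * (α * β) * s) *
          (‖(S s x).fst - (S s y).fst‖ ^ 2 + ‖(S s x).snd - (S s y).snd‖ ^ 2) := by
      congr 1 with s
      rw [PhaseSpace.norm_sq]; rfl
    rw [h3]
    simp only [WithLp.sub_fst, WithLp.sub_snd]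
    rw [zero_div, zero_mul] at h2
    linarith
  · intro t x ht
    have h1 := (hmod x).cone_estimate hα hαβ hlam hlow hhigh hκ0.le hκg.le e1 e2 e3 ht
    have h2 := (hmod x).integral_force_le hθ hC (κ := κ) (ε := ε)
      (fun s _ => sq_norm_le_of_lipschitz hF hLκ _) ht
    simp only [hS.zero] at h1
    simp only [PhaseSpace.norm_sq]
    linarith
  · intro t x y ht ht1
    have hbd : ∀ s ∈ Set.Icc 0 t, ‖S s x - S s y‖ ≤ Real.exp Λ * ‖x - y‖ := fun s hs => by
      refine (hS.norm_sub_le he hlam hF hs.1 x y).trans ?_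
      gcongr
      nlinarith [hs.2]
    have h1 := ((hmod x).sub (hmod y)).norm_starProjection_sub_le (R := Real.exp Λ * ‖x - y‖)
      (L := L) hlam hlow (by positivity) hL ht
      (fun s hs => (PhaseSpace.norm_fst_le (S s x - S s y)).trans (hbd s hs))
      (fun s hs => (PhaseSpace.norm_snd_le (S s x - S s y)).trans (hbd s hs))
      (fun s hs => (hF.norm_sub_le _ _).trans (mul_le_mul_of_nonneg_left
        ((PhaseSpace.norm_fst_le (S s x - S s y)).trans (hbd s hs)) hL))
    refine le_of_sq_le_sq ?_ (by positivity)
    rw [← map_sub, norm_sq_starProjection_base]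
    simp only [hS.zero] at h1
    simp only [WithLp.sub_fst, WithLp.sub_snd]
    refine h1.trans_eq ?_
    have hsq : √(2 * (n : ℝ)) ^ 2 = 2 * n := Real.sq_sqrt (by positivity)
    linear_combination (-((2 * α ^ 2 + L) * Real.exp Λ * t * ‖x - y‖) ^ 2) * hsq

end SpectralGap

/-! ### Resonance excludes a Lipschitz invariant graph. -/

section Obstruction

/-- The weighted energy `e^{-|κ|t}(x² + y²)` does not increase. This is the uniqueness statement
that identifies low modes with explicit solutions. -/
theorem planar_eq_zero {l κ : ℝ} (hl : 0 ≤ l) {x y : ℝ → ℝ}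
    (hx : ∀ t, 0 ≤ t → HasDerivWithinAt x (-l * (x t + y t)) (Set.Ici 0) t)
    (hy : ∀ t, 0 ≤ t → HasDerivWithinAt y (-l * y t + κ * x t) (Set.Ici 0) t)
    (hx0 : x 0 = 0) (hy0 : y 0 = 0) {t : ℝ} (ht : 0 ≤ t) : x t = 0 ∧ y t = 0 := by
  have hd : ∀ s, 0 ≤ s → HasDerivWithinAt (fun s => Real.exp (-|κ| * s) * (x s ^ 2 + y s ^ 2))
      (Real.exp (-|κ| * s) * (-|κ| * (x s ^ 2 + y s ^ 2) +
        2 * x s * (-l * (x s + y s)) + 2 * y s * (-l * y s + κ * x s))) (Set.Ici 0) s := by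
    intro s hs
    have h3 : HasDerivWithinAt (fun s => Real.exp (-|κ| * s)) (Real.exp (-|κ| * s) * -|κ|)
        (Set.Ici 0) s := by
      simpa using ((hasDerivAt_id s).const_mul (-|κ|)).exp.hasDerivWithinAt (s := Set.Ici 0)
    refine (h3.mul (((hx s hs).pow 2).add ((hy s hs).pow 2))).congr_deriv ?_
    simp only [Nat.cast_ofNat, Nat.add_one_sub_one, pow_one, Pi.add_apply, Pi.pow_apply]
    ring
  have h1 := intervalIntegral.sub_le_integral_of_hasDeriv_right_of_le (φ := fun _ => 0) ht
    (fun s hs => (hd s hs.1).continuousWithinAt.mono fun r hr => hr.1)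
    (fun s hs => (hd s hs.1.le).mono (fun r hr => hs.1.le.trans (le_of_lt hr) :
      Set.Ioi s ⊆ Set.Ici 0)) (by simp) fun s _ => by
      refine mul_nonpos_of_nonneg_of_nonpos (Real.exp_pos _).le ?_
      have e1 : 2 * κ * (x s * y s) ≤ |κ| * (x s ^ 2 + y s ^ 2) := by
        have e2 : 2 * |x s * y s| ≤ x s ^ 2 + y s ^ 2 := by
          rw [abs_mul, ← sq_abs (x s), ← sq_abs (y s)]
          nlinarith [sq_nonneg (|x s| - |y s|)]
        have e3 : κ * (x s * y s) ≤ |κ| * |x s * y s| := by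
          rw [← abs_mul]; exact le_abs_self _
        nlinarith [mul_le_mul_of_nonneg_left e2 (abs_nonneg κ)]
      nlinarith [mul_nonneg hl (sq_nonneg (x s + y s)), mul_nonneg hl (sq_nonneg (x s)),
        mul_nonneg hl (sq_nonneg (y s))]
  simp only [hx0, hy0, intervalIntegral.integral_zero] at h1
  have h2 : x t ^ 2 + y t ^ 2 ≤ 0 := by
    refine le_of_mul_le_mul_left ?_ (Real.exp_pos (-|κ| * t))
    linarith
  exact ⟨by nlinarith [sq_nonneg (x t), sq_nonneg (y t)],
    by nlinarith [sq_nonneg (x t), sq_nonneg (y t)]⟩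

variable {H : Type*} [NormedAddCommGroup H] [InnerProductSpace ℝ H]

/-- The operator `-κ` on the span of `e i` and `e j`, plus a coupling `c` from `e i` to `e j`. -/
noncomputable def couplingOp (e : HilbertBasis ℕ ℝ H) (i j : ℕ) (κ c : ℝ) : H →L[ℝ] H :=
  -(κ • ((innerSL ℝ (e i)).smulRight (e i) + (innerSL ℝ (e j)).smulRight (e j))) +
    c • (innerSL ℝ (e i)).smulRight (e j)

variable (e : HilbertBasis ℕ ℝ H) {i j : ℕ} {κ c : ℝ}

theorem couplingOp_apply (x : H) : couplingOp e i j κ c x =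
    -(κ • (⟪x, e i⟫ • e i + ⟪x, e j⟫ • e j)) + c • ⟪x, e i⟫ • e j := by
  simp [couplingOp, real_inner_comm]

theorem inner_basis (k l : ℕ) : ⟪e k, e l⟫ = if k = l then (1 : ℝ) else 0 :=
  orthonormal_iff_ite.1 e.orthonormal k l

theorem inner_couplingOp (x : H) (k : ℕ) : ⟪couplingOp e i j κ c x, e k⟫ =
    -(κ * (⟪x, e i⟫ * (if i = k then 1 else 0) + ⟪x, e j⟫ * (if j = k then 1 else 0))) +
      c * (⟪x, e i⟫ * (if j = k then 1 else 0)) := by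
  rw [couplingOp_apply]
  simp only [inner_add_left, inner_neg_left, real_inner_smul_left, inner_basis]

theorem norm_couplingOp_le (hij : i ≠ j) (hκ : 0 ≤ κ) (hc : 0 ≤ c) :
    ‖couplingOp e i j κ c‖ ≤ κ + c := by
  refine ContinuousLinearMap.opNorm_le_bound _ (by positivity) fun x => ?_
  rw [couplingOp_apply]
  have h1 : ‖⟪x, e i⟫ • e i + ⟪x, e j⟫ • e j‖ ≤ ‖x‖ := by
    refine le_of_sq_le_sq (hasSum_le (fun k => ?_) (hasSum_sq_inner e _) (hasSum_sq_inner e x))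
      (norm_nonneg _)
    simp only [inner_add_left, real_inner_smul_left, inner_basis]
    by_cases hi : i = k
    · subst hi
      rw [if_pos rfl, if_neg hij.symm]
      simp
    · by_cases hj : j = k
      · subst hj
        rw [if_neg hi, if_pos rfl]
        simp
      · rw [if_neg hi, if_neg hj]
        simp [sq_nonneg]
  have h2 : ‖⟪x, e i⟫ • e j‖ ≤ ‖x‖ := by
    rw [norm_smul, e.orthonormal.1 j, mul_one, Real.norm_eq_abs]
    have := abs_real_inner_le_norm x (e i)
    rwa [e.orthonormal.1 i, mul_one] at this
  refine (norm_add_le _ _).trans ?_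
  rw [norm_neg, norm_smul κ, norm_smul c, Real.norm_of_nonneg hκ, Real.norm_of_nonneg hc, add_mul]
  gcongr

variable {e} {A : H →ₗ.[ℝ] H} {lam : ℕ → ℝ} {n : ℕ}

theorem inner_fst_eq_zero_of_mem_orthogonal {q : PhaseSpace H} (hq : q ∈ (base e n)ᗮ) {k : ℕ}
    (hk : k < n) : ⟪q.fst, e k⟫ = 0 ∧ ⟪q.snd, e k⟫ = 0 := by
  constructor
  · have := Submodule.inner_right_of_mem_orthogonal
      (show (WithLp.toLp 2 (e k, (0 : H)) : PhaseSpace H) ∈ base e n from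
        ⟨mem_modes e n hk, Submodule.zero_mem _⟩) hq
    rw [WithLp.prod_inner_apply] at this
    simpa [real_inner_comm] using this
  · have := Submodule.inner_right_of_mem_orthogonal
      (show (WithLp.toLp 2 ((0 : H), e k) : PhaseSpace H) ∈ base e n from
        ⟨Submodule.zero_mem _, mem_modes e n hk⟩) hq
    rw [WithLp.prod_inner_apply] at this
    simpa [real_inner_comm] using this

/-- A forward invariant Lipschitz graph cannot exist if the modes `i` and `n` are in resonance and
are coupled: the backward trajectories over the resonant direction grow too fast. -/
theorem not_exists_invariant_graph (he : IsEigenbasis A lam e) (hlam : ∀ k, 0 ≤ lam k)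
    {α β : ℝ} (hα : 0 < α) (hβ : 0 < β) (hn : n = i + 1) (hi : lam i = α ^ 2)
    (hj : lam n = β ^ 2) (hαβ : α ≤ β) (hc : 0 < c) {S : ℝ → PhaseSpace H → PhaseSpace H}
    (hS : IsSolutionSemigroup A (fun u => couplingOp e i n ((β - α) ^ 2) c u) S)
    {N : Set (PhaseSpace H)} (hinv : ∀ t : ℝ, 0 ≤ t → S t '' N = N)
    {M : base e n → (base e n)ᗮ} {K : ℝ≥0} (hM : LipschitzWith K M)
    (hN : N = Set.range fun p : base e n => (p : PhaseSpace H) + (M p : PhaseSpace H)) : False := by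
  set g := β - α with hg
  have hg0 : 0 ≤ g := sub_nonneg.2 hαβ
  have hin : i < n := by omega
  have hine : i ≠ n := hin.ne
  -- With the force `-g²`, mode `i` has decay rates `α² ± αg`; the vector `(1, g / α)` belongs to
  -- the larger one, `αβ`.
  let p₀ : base e n := ⟨WithLp.toLp 2 (e i, (g / α) • e i),
    ⟨mem_modes e n hin, Submodule.smul_mem _ _ (mem_modes e n hin)⟩⟩
  -- A left eigenvector of mode `n` for the smaller of the rates `β² ± βg`, again `αβ`. With the
  -- coupling, `z' = -αβ z + c u_i`.
  set z : PhaseSpace H → ℝ := fun ξ => ⟪ξ.snd, e n⟫ - g / β * ⟪ξ.fst, e n⟫ with hz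
  have hzle : ∀ ξ, |z ξ| ≤ (1 + g / β) * ‖ξ‖ := by
    intro ξ
    have h1 := abs_real_inner_le_norm ξ.snd (e n)
    have h2 := abs_real_inner_le_norm ξ.fst (e n)
    rw [e.orthonormal.1 n, mul_one] at h1 h2
    have h3 := PhaseSpace.norm_fst_le ξ
    have h4 := PhaseSpace.norm_snd_le ξ
    refine (abs_sub _ _).trans ?_
    rw [abs_mul, abs_of_nonneg (by positivity : 0 ≤ g / β), add_mul, one_mul]
    exact add_le_add (h1.trans h4) (mul_le_mul_of_nonneg_left (h2.trans h3) (by positivity))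
  set Z := |z ((p₀ : PhaseSpace H) + (M p₀ : PhaseSpace H))| with hZ
  set R := Z + (1 + g / β) * ((1 + K) * ‖p₀‖ + ‖M 0‖) with hR
  have hR0 : 0 ≤ R := by positivity
  obtain ⟨T, hT0, hT⟩ : ∃ T : ℝ, 0 ≤ T ∧ R < c * T :=
    ⟨R / c + 1, by positivity, by rw [mul_add, mul_div_cancel₀ _ hc.ne']; linarith⟩
  -- Modes below `n` do not feel mode `n`, so the low modes started at `p` arrive exactly at `p₀` at
  -- time `T`.
  set p : base e n := Real.exp (α * β * T) • p₀ with hp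
  set η : PhaseSpace H := (p : PhaseSpace H) + (M p : PhaseSpace H) with hη
  have hηN : η ∈ N := by rw [hN]; exact ⟨p, rfl⟩
  have hSηN : S T η ∈ N := by rw [← hinv T hT0]; exact ⟨η, hηN, rfl⟩
  have hmod := (hS.isSolution η).isModalSolution he (couplingOp e i n (g ^ 2) c).continuous
  set u : ℕ → ℝ → ℝ := fun k t => ⟪(S t η).fst, e k⟫ with hu
  set v : ℕ → ℝ → ℝ := fun k t => ⟪(S t η).snd, e k⟫ with hv
  have hu' : ∀ k t, 0 ≤ t → HasDerivWithinAt (u k) (-lam k * (u k t + v k t)) (Set.Ici 0) t :=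
    hmod.deriv_fst
  have hv' : ∀ k t, 0 ≤ t → HasDerivWithinAt (v k) (-lam k * v k t +
      (-(g ^ 2 * (u i t * (if i = k then 1 else 0) + u n t * (if n = k then 1 else 0))) +
        c * (u i t * (if n = k then 1 else 0)))) (Set.Ici 0) t := fun k t ht => by
    have := hmod.deriv_snd k t ht
    rwa [inner_couplingOp] at this
  have hu0 : ∀ k, k < n → u k 0 = Real.exp (α * β * T) * (if i = k then 1 else 0) := by
    intro k hk
    simp only [hu, hS.zero, hη, WithLp.add_fst]
    rw [inner_add_left, (inner_fst_eq_zero_of_mem_orthogonal (M p).2 hk).1, add_zero, hp,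
      ← inner_basis e, ← real_inner_smul_left]
    rfl
  have hv0 : ∀ k, k < n → v k 0 = Real.exp (α * β * T) * (g / α * (if i = k then 1 else 0)) := by
    intro k hk
    simp only [hv, hS.zero, hη, WithLp.add_snd]
    rw [inner_add_left, (inner_fst_eq_zero_of_mem_orthogonal (M p).2 hk).2, add_zero, hp,
      ← inner_basis e, ← real_inner_smul_left, ← real_inner_smul_left]
    rfl
  have hui : ∀ t, 0 ≤ t → u i t = Real.exp (α * β * (T - t)) ∧
      v i t = g / α * Real.exp (α * β * (T - t)) := by
    intro t ht
    have hexp : ∀ t, HasDerivWithinAt (fun t => Real.exp (α * β * (T - t)))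
        (-(α * β) * Real.exp (α * β * (T - t))) (Set.Ici 0) t := fun t =>
      ((((hasDerivAt_id t).const_sub T).const_mul (α * β)).exp.congr_deriv
        (by simp only [id]; ring)).hasDerivWithinAt
    have hgα : g / α * α = g := div_mul_cancel₀ _ hα.ne'
    have hβα : β = g + α := by rw [hg]; ring
    have h := planar_eq_zero (l := lam i) (κ := -g ^ 2) (hlam i)
      (x := fun t => u i t - Real.exp (α * β * (T - t)))
      (y := fun t => v i t - g / α * Real.exp (α * β * (T - t)))
      (fun t ht => ((hu' i t ht).sub (hexp t)).congr_deriv (by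
        rw [hi]
        linear_combination (Real.exp (α * β * (T - t)) * α) * (hβα - hgα)))
      (fun t ht => ((hv' i t ht).sub ((hexp t).const_mul (g / α))).congr_deriv (by
        rw [if_pos rfl, if_neg hine.symm, hi]
        linear_combination (Real.exp (α * β * (T - t)) * (g / α) * α) * hβα +
          (Real.exp (α * β * (T - t)) * g) * hgα))
      (by simp [hu0 i hin]) (by simp [hv0 i hin]; ring) ht
    exact ⟨sub_eq_zero.1 h.1, sub_eq_zero.1 h.2⟩
  have huk : ∀ k, k < i → u k T = 0 ∧ v k T = 0 := fun k hk => by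
    have hne : i ≠ k := hk.ne'
    have hne' : n ≠ k := (hk.trans hin).ne'
    exact planar_eq_zero (κ := 0) (hlam k) (hu' k)
      (fun t ht => (hv' k t ht).congr_deriv (by rw [if_neg hne, if_neg hne']; ring))
      (by rw [hu0 k (hk.trans hin), if_neg hne, mul_zero])
      (by rw [hv0 k (hk.trans hin), if_neg hne, mul_zero, mul_zero]) hT0
  -- Invariance keeps the endpoint on the graph over `p₀`, so it does not depend on `T`.
  have hend : S T η = (p₀ : PhaseSpace H) + (M p₀ : PhaseSpace H) := by
    rw [hN] at hSηN
    obtain ⟨p', hp'⟩ := hSηN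
    have hcoord : ∀ k, k < n → ⟪(p' : PhaseSpace H).fst, e k⟫ = u k T ∧
        ⟪(p' : PhaseSpace H).snd, e k⟫ = v k T := by
      intro k hk
      have h1 := inner_fst_eq_zero_of_mem_orthogonal (M p').2 hk
      simp only [hu, hv, ← hp', WithLp.add_fst, WithLp.add_snd, inner_add_left, h1.1, h1.2,
        add_zero, and_self]
    have hfst : (p' : PhaseSpace H).fst = (p₀ : PhaseSpace H).fst := by
      refine e.ext_inner fun k => ?_
      rcases lt_or_ge k n with hk | hk
      · rw [(hcoord k hk).1]
        change _ = ⟪e i, e k⟫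
        rw [inner_basis]
        rcases (Nat.lt_succ_iff.1 (hn ▸ hk)).eq_or_lt with rfl | hk'
        · rw [(hui T hT0).1]; simp
        · rw [(huk k hk').1, if_neg hk'.ne']
      · exact (inner_eq_zero_of_mem_modes e n p'.2.1 hk).trans
          (inner_eq_zero_of_mem_modes e n p₀.2.1 hk).symm
    have hsnd : (p' : PhaseSpace H).snd = (p₀ : PhaseSpace H).snd := by
      refine e.ext_inner fun k => ?_
      rcases lt_or_ge k n with hk | hk
      · rw [(hcoord k hk).2]
        change _ = ⟪(g / α) • e i, e k⟫
        rw [real_inner_smul_left, inner_basis]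
        rcases (Nat.lt_succ_iff.1 (hn ▸ hk)).eq_or_lt with rfl | hk'
        · rw [(hui T hT0).2]; simp
        · rw [(huk k hk').2, if_neg hk'.ne', mul_zero]
      · exact (inner_eq_zero_of_mem_modes e n p'.2.2 hk).trans
          (inner_eq_zero_of_mem_modes e n p₀.2.2 hk).symm
    have hpp : p' = p₀ := by
      refine Subtype.ext ((WithLp.equiv 2 (H × H)).injective (Prod.ext hfst hsnd))
    rw [← hp', hpp]
  -- the resonant functional
  have hzd : ∀ t, 0 ≤ t → HasDerivWithinAt
      (fun t => Real.exp (α * β * t) * (v n t - g / β * u n t)) (c * Real.exp (α * β * T))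
      (Set.Ici 0) t := by
    intro t ht
    have h3 : HasDerivWithinAt (fun t => Real.exp (α * β * t)) (Real.exp (α * β * t) * (α * β))
        (Set.Ici 0) t := by
      simpa using ((hasDerivAt_id t).const_mul (α * β)).exp.hasDerivWithinAt (s := Set.Ici 0)
    refine (h3.mul ((hv' n t ht).sub ((hu' n t ht).const_mul (g / β)))).congr_deriv ?_
    have hgβ : g / β * β = g := div_mul_cancel₀ _ hβ.ne'
    have e1 : Real.exp (α * β * T) = Real.exp (α * β * t) * u i t := by
      rw [(hui t ht).1, ← Real.exp_add]; ring_nf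
    rw [e1, if_neg hine, if_pos rfl, hj]
    simp only [Pi.sub_apply]
    have hβα : β = g + α := by rw [hg]; ring
    linear_combination (Real.exp (α * β * t) * (β * (u n t + v n t) - α * u n t)) * hgβ -
      (Real.exp (α * β * t) * (β * v n t - g * u n t)) * hβα
  have hzint := intervalIntegral.integral_eq_sub_of_hasDeriv_right_of_le hT0
    (fun s hs => (hzd s hs.1).continuousWithinAt.mono fun r hr => hr.1)
    (fun s hs => (hzd s hs.1.le).mono (fun r hr => hs.1.le.trans (le_of_lt hr) :
      Set.Ioi s ⊆ Set.Ici 0)) (by simp)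
  have hzT : v n T - g / β * u n T = z ((p₀ : PhaseSpace H) + (M p₀ : PhaseSpace H)) := by
    rw [← hend]
  have hz0 : v n 0 - g / β * u n 0 = z η := by simp only [hu, hv, hS.zero, hz]
  rw [intervalIntegral.integral_const, hzT, hz0] at hzint
  simp only [sub_zero, smul_eq_mul, mul_zero, Real.exp_zero, one_mul] at hzint
  have hE : 1 ≤ Real.exp (α * β * T) := Real.one_le_exp (by positivity)
  have hηn : ‖η‖ ≤ Real.exp (α * β * T) * ((1 + K) * ‖p₀‖ + ‖M 0‖) := by
    have h1 : ‖p‖ = Real.exp (α * β * T) * ‖p₀‖ := by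
      rw [hp, norm_smul, Real.norm_of_nonneg (Real.exp_pos _).le]
    have h2 := hM.norm_sub_le p 0
    have h3 := norm_add_le (M p - M 0) (M 0)
    rw [sub_add_cancel] at h3
    rw [sub_zero, h1] at h2
    have h4 : ‖η‖ ≤ ‖p‖ + ‖M p‖ := norm_add_le _ _
    have h5 : ‖M 0‖ ≤ Real.exp (α * β * T) * ‖M 0‖ := le_mul_of_one_le_left (norm_nonneg _) hE
    linarith
  have h6 : -z η ≤ (1 + g / β) * (Real.exp (α * β * T) * ((1 + K) * ‖p₀‖ + ‖M 0‖)) :=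
    (neg_le_abs _).trans ((hzle η).trans (mul_le_mul_of_nonneg_left hηn (by positivity)))
  have h7 : Real.exp (α * β * T) * z ((p₀ : PhaseSpace H) + (M p₀ : PhaseSpace H)) ≤
      Real.exp (α * β * T) * Z :=
    mul_le_mul_of_nonneg_left (le_abs_self _) (Real.exp_pos _).le
  -- Resonance makes `e^{αβt} z` increase by `c T e^{αβT}`, while the Lipschitz graph allows at both
  -- ends only a multiple of `e^{αβT}` independent of `T`.
  have h8 : Real.exp (α * β * T) * (c * T) ≤ Real.exp (α * β * T) * R := by
    rw [hR]; linarith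
  linarith [le_of_mul_le_mul_left h8 (Real.exp_pos _)]

end Obstruction

theorem theorem3p5 {H : Type*} [NormedAddCommGroup H] [InnerProductSpace ℝ H] [CompleteSpace H]
    (A : H →ₗ.[ℝ] H) (hA : IsPosSelfAdjointCompactInv A)
    (lam : ℕ → ℝ) (e : HilbertBasis ℕ ℝ H) (he : IsEigenbasis A lam e)
    (n : ℕ) (hn : 1 ≤ n) (L : ℝ≥0) :
    -- `λ_n = lam (n - 1)` and `λ_{n+1} = lam n`
    (√(lam n) - √(lam (n - 1)) > √(L : ℝ) →
      ∀ F : H → H, LipschitzWith L F →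
        Module.finrank ℝ (base e n) = 2 * n ∧
        ∃ S : ℝ → PhaseSpace H → PhaseSpace H, IsSolutionSemigroup A F S ∧
          ∃ N : Set (PhaseSpace H),
            IsInertialManifold S e n (√(lam (n - 1) * lam n)) N) ∧
    (√(lam n) - √(lam (n - 1)) < √(L : ℝ) →
      ∃ F : H →L[ℝ] H, ‖F‖ ≤ (L : ℝ) ∧
        ∃ S : ℝ → PhaseSpace H → PhaseSpace H, IsSolutionSemigroup A (fun u => F u) S ∧
          ¬ ∃ (θ : ℝ) (N : Set (PhaseSpace H)), IsInertialManifold S e n θ N) := by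
  have hlam : ∀ k, 0 ≤ lam k := fun k => (he.pos hA k).le
  set α := √(lam (n - 1)) with hα
  set β := √(lam n) with hβ
  have hα0 : 0 < α := Real.sqrt_pos.2 (he.pos hA _)
  have hβ0 : 0 < β := Real.sqrt_pos.2 (he.pos hA _)
  have hα2 : lam (n - 1) = α ^ 2 := (Real.sq_sqrt (hlam _)).symm
  have hβ2 : lam n = β ^ 2 := (Real.sq_sqrt (hlam _)).symm
  constructor
  · intro hgap F hF
    have hgap0 : 0 < β - α := (Real.sqrt_nonneg _).trans_lt hgap
    obtain ⟨S, hS⟩ := exists_isSolutionSemigroup he hA hF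
    obtain ⟨V, Λ, ε, a, b, c, C, D, hcone⟩ := hS.exists_coneSystem (n := n) he hF hlam hα0
      (sub_pos.1 hgap0) ((Real.sqrt_lt' hgap0).1 hgap)
      (fun k hk => hα2 ▸ he.mono (Nat.le_sub_one_of_lt hk)) (fun k hk => hβ2 ▸ he.mono hk)
    obtain ⟨N, hclosed, hinv, hgraph, htrack⟩ := hcone.exists_inertialManifold
    refine ⟨finrank_base e n, S, hS, N, ?_⟩
    rw [Real.sqrt_mul (hlam _)]
    exact ⟨hclosed, hinv, hgraph, mul_pos hα0 hβ0, htrack⟩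
  · intro hgap
    have hαβ : α ≤ β := Real.sqrt_le_sqrt (he.mono (Nat.sub_le n 1))
    have hc : 0 < (L : ℝ) - (β - α) ^ 2 :=
      sub_pos.2 ((Real.lt_sqrt (sub_nonneg.2 hαβ)).1 hgap)
    -- The part `(β - α) ^ 2` of the admissible norm makes two decay rates coincide; the positive
    -- remainder is the coupling, and together they use up `L`.
    obtain ⟨S, hS⟩ := exists_isSolutionSemigroup he hA
      (couplingOp e (n - 1) n ((β - α) ^ 2) (L - (β - α) ^ 2)).lipschitz
    refine ⟨couplingOp e (n - 1) n ((β - α) ^ 2) (L - (β - α) ^ 2),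
      (norm_couplingOp_le e (by omega) (sq_nonneg _) hc.le).trans_eq (by ring), S, hS, ?_⟩
    rintro ⟨θ, N, hN⟩
    obtain ⟨M, K, hM, hNM⟩ := hN.graph
    exact not_exists_invariant_graph he hlam hα0 hβ0 (by omega) hα2 hβ2 hαβ hc hS hN.invariant
      hM hNM
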